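/- Let $X$ be a set with at least two points. A quasi-metric on $X$ is a function $\rho:X\times X\to[0,\infty)$ such that $\rho(x,y)=0\iff x=y$, $\rho(y,x)\le C_0\,\rho(x,y)$ and $\rho(x,y)\le C_1\max\{\rho(x,z),\rho(z,y)\}$ for all $x,y,z\in X$, with constants $C_0,C_1>0$. Write $B_\rho(x,r)=\{y\in X:\rho(x,y)<r\}$, let $\sigma B$ be the ball with the same center as $B$ and $\sigma$ times its radius, and let $$C_\rho=\sup\Big\{\tfrac{\rho(x,y)}{\max\{\rho(x,z),\rho(z,y)\}}:\ x,y,z\in X\text{ not all equal}\Big\}\in[1,\infty),\qquad \mathrm{ind}(X,\rho)=\sup_{\varrho\approx\rho}(\log_2C_\varrho)^{-1}\in(0,\infty],$$ where the last supremum is over all quasi-metrics $\varrho$ on $X$ with $c^{-1}\rho\le\varrho\le c\rho$ for some constant $c>0$, and $(\log_2 1)^{-1}:=\infty$. For $s\in(0,\infty)$ and $q\in(0,\infty]$, $s\preceq_q\mathrm{ind}(X,\rho)$ means that $s\le\mathrm{ind}(X,\rho)$, where $s=\mathrm{ind}(X,\rho)$ is permitted only if $q=\infty$ and the supremum defining $\mathrm{ind}(X,\rho)$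 is attained. A quasi-metric measure space $(X,\rho,\mu)$ is such a pair $(X,\rho)$ with a nonnegative Borel measure $\mu$ (for the topology generated by $\rho$) such that every ball is $\mu$-measurable and $0<\mu(B_\rho(x,r))<\infty$ for all $x\in X$, $r\in(0,\infty)$. It is uniformly perfect if there is $\lambda\in(0,1)$ such that, for all $x\in X$ and $r\in(0,\infty)$, $B_\rho(x,r)\setminus B_\rho(x,\lambda r)\ne\emptyset$ whenever $X\setminus B_\rho(x,r)\neq\emptyset$. The measure $\mu$ is doubling if there is $C>0$ with $\mu(B_\rho(x,2r))\le C\mu(B_\rho(x,r))$ for all $x\in X$, $r\in(0,\infty)$. For a ball $E\subset X$ and a $\mu$-measurable function $u:E\to\mathbb R$, a fractional $s$-gradient of $u$ on $E$ is a sequence $\vec g=\{g_k\}_{k\in\mathbb Z}$ of nonnegative $\mu$-measurable functions on $E$ for which there is a $\mu$-null set $N$ such that $|u(x)-u(y)|\le\rho(x,y)^s\,[g_k(x)+g_k(y)]$ for all $k\in\mathbb Z$ and all $x,y\in E\setminus N$ with $2^{-k-1}\le\rho(x,y)<2^{-k}$. For $p\in(0,\infty)$ put $\|u\|_{\dot M^s_{p,q}(E)}=\inf_{\vec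 g}\big\|\,\|\{g_k\}_{k\in\mathbb Z}\|_{\ell^q}\big\|_{L^p(E,\mu)}$, the infimum being over all fractional $s$-gradients of $u$ on $E$ ($\inf\emptyset=\infty$), and let $\dot M^s_{p,q}(E,\rho,\mu)$ be the set of all $\mu$-measurable $u:E\to\mathbb R$ with $\|u\|_{\dot M^s_{p,q}(E)}<\infty$. **Theorem.** Let $(X,\rho,\mu)$ be a uniformly perfect quasi-metric measure space, $\sigma\in[C_\rho,\infty)$ and $q\in(0,\infty]$, and let $s\in(0,\infty)$ satisfy $s\preceq_q\mathrm{ind}(X,\rho)$. Then the following two statements are equivalent. (a) The measure $\mu$ is doubling. (b) There exist positive constants $c_1,c_2,p,\omega$ such that, for every ball $B_0=B_\rho(x_0,R_0)$ with $x_0\in X$ and $R_0\in(0,\infty)$, and every $u\in\dot M^s_{p,q}(\sigma B_0,\rho,\mu)$ with $\|u\|_{\dot M^s_{p,q}(\sigma B_0)}>0$, the function $u$ is integrable on $B_0$ and $$\frac1{\mu(B_0)}\int_{B_0}\exp\left[\left(c_1\,\frac{[\mu(\sigma B_0)]^{1/p}\,|u-u_{B_0}|}{R_0^s\,\|u\|_{\dot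 M^s_{p,q}(\sigma B_0)}}\right)^{\omega}\right]d\mu\le c_2,\qquad u_{B_0}:=\frac1{\mu(B_0)}\int_{B_0}u\,d\mu.$$ -/

import Mathlib

open MeasureTheory
open scoped NNReal ENNReal

noncomputable section

namespace QuasiMetric

/-- `ρ` is a quasi-metric on `X`: nonnegative, nondegenerate, quasi-symmetric and quasi-subadditive. -/
structure IsQuasiMetric {X : Type*} (ρ : X → X → ℝ) : Prop where
  nonneg : ∀ x y, 0 ≤ ρ x y
  eq_zero_iff : ∀ x y, ρ x y = 0 ↔ x = y
  quasi_symm : ∃ C₀ : ℝ, 0 < C₀ ∧ ∀ x y, ρ y x ≤ C₀ * ρ x y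
  quasi_subadd : ∃ C₁ : ℝ, 0 < C₁ ∧ ∀ x y z, ρ x y ≤ C₁ * max (ρ x z) (ρ z y)

/-- The `ρ`-ball `B_ρ(x, r) = {y : ρ(x, y) < r}`. -/
def qball {X : Type*} (ρ : X → X → ℝ) (x : X) (r : ℝ) : Set X := {y | ρ x y < r}

/-- The topology `τ_ρ`: a set is open when it contains a `ρ`-ball around each of its points. -/
abbrev qtopology {X : Type*} (ρ : X → X → ℝ) : TopologicalSpace X where
  IsOpen U := ∀ x ∈ U, ∃ r : ℝ, 0 < r ∧ qball ρ x r ⊆ U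
  isOpen_univ := fun _ _ => ⟨1, one_pos, Set.subset_univ _⟩
  isOpen_inter := by
    rintro U V hU hV x ⟨hxU, hxV⟩
    obtain ⟨r, hr, hrU⟩ := hU x hxU
    obtain ⟨t, ht, htV⟩ := hV x hxV
    refine ⟨min r t, lt_min hr ht, fun y hy => ?_⟩
    have hy' : ρ x y < min r t := hy
    exact ⟨hrU (lt_of_lt_of_le hy' (min_le_left _ _)),
      htV (lt_of_lt_of_le hy' (min_le_right _ _))⟩
  isOpen_sUnion := by
    rintro S hS x ⟨U, hU, hxU⟩
    obtain ⟨r, hr, hrU⟩ := hS U hU x hxU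
    exact ⟨r, hr, hrU.trans (Set.subset_sUnion_of_mem hU)⟩

/-- The least constant `C_ρ` in `ρ(x, y) ≤ C max {ρ(x, z), ρ(z, y)}`: the supremum of
`ρ(x, y) / max {ρ(x, z), ρ(z, y)}` over all `x, y, z` that are not all equal. -/
def qconst {X : Type*} (ρ : X → X → ℝ) : ℝ :=
  sSup {t : ℝ | ∃ x y z : X, ¬ (x = y ∧ y = z) ∧ t = ρ x y / max (ρ x z) (ρ z y)}

/-- `ρ ≈ ϱ`: the two functions are pointwise comparable. -/
def Equivalent {X : Type*} (ρ ϱ : X → X → ℝ) : Prop :=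
  ∃ c : ℝ, 0 < c ∧ ∀ x y, c⁻¹ * ϱ x y ≤ ρ x y ∧ ρ x y ≤ c * ϱ x y

/-- `(log₂ C_ρ)⁻¹ ∈ (0, ∞]`, with value `∞` when `C_ρ = 1`. -/
def smoothnessExponent {X : Type*} (ρ : X → X → ℝ) : ℝ≥0∞ :=
  (ENNReal.ofReal (Real.logb 2 (qconst ρ)))⁻¹

/-- The lower smoothness index `ind (X, ρ)`: the supremum of `(log₂ C_ϱ)⁻¹` over all
quasi-metrics `ϱ` on `X` with `ϱ ≈ ρ`. -/
def lowerIndex {X : Type*} (ρ : X → X → ℝ) : ℝ≥0∞ :=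
  ⨆ (ϱ : X → X → ℝ) (_ : IsQuasiMetric ϱ ∧ Equivalent ϱ ρ), smoothnessExponent ϱ

/-- `s ⪯_q ind (X, ρ)`: `s ≤ ind (X, ρ)`, and equality is permitted only when `q = ∞` and the
supremum defining the index is attained. -/
def LEIndex {X : Type*} (ρ : X → X → ℝ) (q : ℝ≥0∞) (s : ℝ) : Prop :=
  ENNReal.ofReal s ≤ lowerIndex ρ ∧
    (ENNReal.ofReal s = lowerIndex ρ →
      q = ∞ ∧ ∃ ϱ : X → X → ℝ, IsQuasiMetric ϱ ∧ Equivalent ϱ ρ ∧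
        smoothnessExponent ϱ = lowerIndex ρ)

/-- `(X, ρ, μ)` is a quasi-metric measure space: `X` has at least two points, `ρ` is a
quasi-metric, every set that is Borel for `τ_ρ` is measurable, and all balls are `μ`-measurable
(measurable for the completion of `μ`) with positive finite measure. -/
structure IsQuasiMetricMeasureSpace {X : Type*} [m : MeasurableSpace X]
    (ρ : X → X → ℝ) (μ : Measure X) : Prop where
  nontrivial : Nontrivial X
  quasiMetric : IsQuasiMetric ρ
  borel_le : @borel X (qtopology ρ) ≤ m
  nullMeasurableSet_ball : ∀ (x : X) (r : ℝ), 0 < r → NullMeasurableSet (qball ρ x r) μ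
  measure_ball_pos : ∀ (x : X) (r : ℝ), 0 < r → 0 < μ (qball ρ x r)
  measure_ball_lt_top : ∀ (x : X) (r : ℝ), 0 < r → μ (qball ρ x r) < ∞

/-- Uniform perfectness of `(X, ρ)`. -/
def IsUniformlyPerfect {X : Type*} (ρ : X → X → ℝ) : Prop :=
  ∃ lam : ℝ, 0 < lam ∧ lam < 1 ∧ ∀ (x : X) (r : ℝ), 0 < r →
    (Set.univ \ qball ρ x r).Nonempty → (qball ρ x r \ qball ρ x (lam * r)).Nonempty

/-- The measure `μ` is doubling on `(X, ρ)`. -/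
def IsDoubling {X : Type*} [MeasurableSpace X] (ρ : X → X → ℝ) (μ : Measure X) : Prop :=
  ∃ C : ℝ, 0 < C ∧ ∀ (x : X) (r : ℝ), 0 < r →
    μ (qball ρ x (2 * r)) ≤ ENNReal.ofReal C * μ (qball ρ x r)

/-- `g = {g_k}` is a fractional `s`-gradient of `u` on the space `(E, ρ, μ)`, for `E ⊆ X`.
Only the values of `u` and of the `g_k` on `E` matter. -/
def IsFracGradient {X : Type*} [MeasurableSpace X] (ρ : X → X → ℝ) (μ : Measure X) (s : ℝ)
    (E : Set X) (u : X → ℝ) (g : ℤ → X → ℝ≥0) : Prop :=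
  (∀ k, AEMeasurable (g k) (μ.restrict E)) ∧
    ∃ N : Set X, μ N = 0 ∧ ∀ k : ℤ, ∀ x ∈ E \ N, ∀ y ∈ E \ N,
      (2 : ℝ) ^ (-k - 1) ≤ ρ x y → ρ x y < (2 : ℝ) ^ (-k) →
        |u x - u y| ≤ ρ x y ^ s * ((g k x : ℝ) + (g k y : ℝ))

/-- The `ℓ^q` (quasi-)norm of a nonnegative sequence indexed by `ℤ`, `0 < q ≤ ∞`. -/
def lqNorm (q : ℝ≥0∞) (a : ℤ → ℝ≥0) : ℝ≥0∞ :=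
  if q = ∞ then ⨆ k, (a k : ℝ≥0∞)
  else (∑' k, (a k : ℝ≥0∞) ^ q.toReal) ^ (1 / q.toReal)

/-- The (quasi-)norm of `{g_k}` in `L^p(E, ℓ^q)`. -/
def mixedNorm {X : Type*} [MeasurableSpace X] (μ : Measure X) (p : ℝ) (q : ℝ≥0∞)
    (E : Set X) (g : ℤ → X → ℝ≥0) : ℝ≥0∞ :=
  (∫⁻ x in E, lqNorm q (fun k => g k x) ^ p ∂μ) ^ (1 / p)

/-- The homogeneous Hajłasz–Triebel–Lizorkin (quasi-)semi-norm of `u` on `(E, ρ, μ)`: the infimum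
of the `L^p(E, ℓ^q)` norms of its fractional `s`-gradients (`∞` if there are none). -/
def htlNorm {X : Type*} [MeasurableSpace X] (ρ : X → X → ℝ) (μ : Measure X) (s p : ℝ) (q : ℝ≥0∞)
    (E : Set X) (u : X → ℝ) : ℝ≥0∞ :=
  ⨅ (g : ℤ → X → ℝ≥0) (_ : IsFracGradient ρ μ s E u g), mixedNorm μ p q E g

/-- `u` belongs to the homogeneous Hajłasz–Triebel–Lizorkin space on `(E, ρ, μ)`: it is
`μ`-measurable on `E` and its semi-norm is finite. -/
def MemHTL {X : Type*} [MeasurableSpace X] (ρ : X → X → ℝ) (μ : Measure X) (s p : ℝ) (q : ℝ≥0∞)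
    (E : Set X) (u : X → ℝ) : Prop :=
  AEMeasurable u (μ.restrict E) ∧ htlNorm ρ μ s p q E u < ∞

end QuasiMetric

end

/-! (a) ⇒ (b). If `μ` doubles with constant C, a ball shrunk by 2^{-i} loses at most a factor C^i of
measure. The exponent `p` is free, so it is taken above log₂C / s, the regime of Morrey's embedding.
The ℓ^q norm of a fractional gradient is a Hajłasz gradient G, and each ball B(x, 2^{-i}R₀) contains
a point y_i where G^p is at most its mean. Thus G(y_i) grows at most like C^{i/p}, which the factor
2^{-is} beats. Telescoping along (y_i) bounds the oscillation of u on B₀, and a bounded exponent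
makes the exponential bound trivial with ω = 1.

(b) ⇒ (a). The condition on the index yields t ≥ s for which ρ^t is comparable to a pseudometric:
Frink's lemma applied to a power with quasi-triangle constant at most 2. The distance f to x₀ is
then t-Hölder with respect to ρ, and cut-offs of f have a controlled seminorm. Let B = B(x₀, 2r),
and let S_j be decreasing sublevel sets of f inside B(x₀, r), all containing one fixed ball. Testing
(b) on a cut-off equal to 1 on S_{j+1} and 0 off S_j, with exp bounded below by a power, gives
a_{j+1} ≤ K b^j a_j² for a_j = μ(S_j)/μ(B). All radii cancel in K and b. Were a_0 below a threshold
δ(K, b), then a_j would tend to 0, contradicting the fixed ball. Hence μ(B(x₀, r)) ≥ δ μ(B(x₀, 2r)).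

The main lemmas are `IsDoubling.oscillation_le`, `LEIndex.exists_pseudoMetric`,
`exists_seq_lqNorm_le` and `measureReal_le_of_exp_integrable`. -/

namespace QuasiMetric

/-! ### Frink's metrization lemma -/

/-- **Frink's chain lemma.** -/
theorem frink_chain {X : Type*} {d : X → X → ℝ≥0}
    (hd : ∀ x y z, d x y ≤ 2 * max (d x z) (d z y)) (x : ℕ → X) (n i : ℕ) :
    (d (x i) (x (i + (n + 2))) : ℝ) + 2 * (d (x i) (x (i + 1)) : ℝ)
        + 2 * (d (x (i + (n + 1))) (x (i + (n + 2))) : ℝ)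
      ≤ 4 * ∑ k ∈ Finset.range (n + 2), (d (x (i + k)) (x (i + k + 1)) : ℝ) := by
  induction n using Nat.strong_induction_on generalizing i with
  | _ n ih =>
  have hd' : ∀ x y z, (d x y : ℝ) ≤ 2 * max (d x z : ℝ) (d z y) := fun a b c => by
    exact_mod_cast hd a b c
  -- An edge of the chain whose right end is far from the start and whose left end is far from the
  -- finish. Otherwise "far from the finish" would pass from each vertex to the next, up to the
  -- finish itself.
  obtain ⟨m, hm, hm1, hm2⟩ : ∃ m, m < n + 2 ∧
      (d (x i) (x (i + (n + 2))) : ℝ) ≤ 2 * d (x (i + m)) (x (i + (n + 2))) ∧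
      (d (x i) (x (i + (n + 2))) : ℝ) ≤ 2 * d (x i) (x (i + (m + 1))) := by
    by_contra! hcon
    have key : ∀ m, m ≤ n + 2 →
        (d (x i) (x (i + (n + 2))) : ℝ) ≤ 2 * d (x (i + m)) (x (i + (n + 2))) := by
      intro m
      induction m with
      | zero => intro _; simp only [add_zero]; linarith [(d (x i) (x (i + (n + 2)))).coe_nonneg]
      | succ m ihm =>
        intro hm
        have h1 := hcon m (by omega) (ihm (by omega))
        have h2 := hd' (x i) (x (i + (n + 2))) (x (i + (m + 1)))
        rcases le_max_iff.1 (le_refl (max (d (x i) (x (i + (m + 1))) : ℝ)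
          (d (x (i + (m + 1))) (x (i + (n + 2))) : ℝ))) with h | h <;> linarith
    have h1 := hcon (n + 1) (by omega) (key (n + 1) (by omega))
    linarith [(d (x i) (x (i + (n + 1 + 1)))).coe_nonneg]
  have hsplit : ∀ a b, a + b = n + 2 →
      ∑ k ∈ Finset.range (n + 2), (d (x (i + k)) (x (i + k + 1)) : ℝ) =
        ∑ k ∈ Finset.range a, (d (x (i + k)) (x (i + k + 1)) : ℝ)
        + ∑ k ∈ Finset.range b, (d (x (i + a + k)) (x (i + a + k + 1)) : ℝ) := by
    intro a b hab
    rw [← hab, Finset.sum_range_add]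
    simp only [add_assoc]
  have hnn : ∀ a j, 0 ≤ ∑ k ∈ Finset.range a, (d (x (j + k)) (x (j + k + 1)) : ℝ) :=
    fun a j => Finset.sum_nonneg fun k _ => NNReal.coe_nonneg _
  have hfirst := hsplit 1 (n + 1) (by omega)
  have hlast := hsplit (n + 1) 1 (by omega)
  simp only [Finset.sum_range_one, add_zero] at hfirst hlast
  rw [show i + (n + 1) + 1 = i + (n + 2) by omega] at hlast
  have hends : (d (x i) (x (i + 1)) : ℝ) + d (x (i + (n + 1))) (x (i + (n + 2)))
      ≤ ∑ k ∈ Finset.range (n + 2), (d (x (i + k)) (x (i + k + 1)) : ℝ) := by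
    rw [hfirst, Finset.sum_range_succ]
    rw [show i + 1 + n = i + (n + 1) by omega, show i + (n + 1) + 1 = i + (n + 2) by omega]
    have := hnn n (i + 1)
    linarith
  -- If the edge is the first or the last one, a subchain would be the whole chain and induction is
  -- unavailable; but then that single edge already has at least half the total distance.
  rcases Nat.eq_zero_or_pos m with rfl | hmpos
  · simp only [zero_add] at hm2
    have := (d (x (i + (n + 1))) (x (i + (n + 2)))).coe_nonneg
    linarith
  rcases Nat.lt_or_ge n m with hnm | hnm
  · obtain rfl : m = n + 1 := by omega
    have := (d (x i) (x (i + 1))).coe_nonneg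
    linarith
  obtain ⟨a, rfl⟩ : ∃ a, m = a + 1 := ⟨m - 1, by omega⟩
  obtain ⟨b, rfl⟩ : ∃ b, n = a + 1 + b := ⟨n - (a + 1), by omega⟩
  -- The two subchains share the middle edge. Its double count in the sums is absorbed by the terms
  -- 2d(last edge) and 2d(first edge) on the left of the two inductive bounds.
  have h1 := ih a (by omega) i
  have h2 := ih b (by omega) (i + (a + 1))
  have h3 := hsplit (a + 1) (b + 2) (by omega)
  rw [Finset.sum_range_succ] at h1
  rw [show i + (a + 1) + 1 = i + (a + 2) by omega] at h1 h2
  rw [show i + (a + 1) + (b + 2) = i + (a + 1 + b + 2) by omega,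
    show i + (a + 1) + (b + 1) = i + (a + 1 + b + 1) by omega] at h2
  rw [show i + (a + 1 + 1) = i + (a + 2) by omega] at hm2
  linarith

/-- `PseudoMetricSpace.ofPreNNDist` takes an infimum over lists of intermediate points; this
translates a list into the indexed chains of `frink_chain`. -/
theorem exists_chain {X : Type*} (d : X → X → ℝ≥0) (l : List X) (x y : X) :
    ∃ f : ℕ → X, f 0 = x ∧ f (l.length + 1) = y ∧
      ((x :: l).zipWith d (l ++ [y])).sum = ∑ k ∈ Finset.range (l.length + 1), d (f k) (f (k + 1)) := by
  induction l generalizing x with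
  | nil => exact ⟨fun n => Nat.casesOn n x fun _ => y, rfl, rfl, by simp⟩
  | cons a l ih =>
    obtain ⟨f, h0, h1, h2⟩ := ih a
    refine ⟨fun n => Nat.casesOn n x f, rfl, h1, ?_⟩
    rw [List.length_cons, Finset.sum_range_succ']
    simp only [List.cons_append, List.zipWith_cons_cons, List.sum_cons] at h2 ⊢
    rw [h2, add_comm]
    exact congrArg _ (congrArg (d x) h0.symm)

/-- **Frink's metrization lemma**: the chain pseudometric of a symmetric function with
quasi-triangle constant `2` is comparable to that function. -/
theorem le_four_mul_dist_ofPreNNDist {X : Type*} (d : X → X → ℝ≥0) (d_self : ∀ x, d x x = 0)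
    (d_comm : ∀ x y, d x y = d y x) (hd : ∀ x y z, d x y ≤ 2 * max (d x z) (d z y)) (x y : X) :
    (d x y : ℝ) ≤ 4 * @dist X
      (@PseudoMetricSpace.toDist X (PseudoMetricSpace.ofPreNNDist d d_self d_comm)) x y := by
  rw [PseudoMetricSpace.dist_ofPreNNDist, show (4 : ℝ) = ((4 : ℝ≥0) : ℝ) by norm_num,
    ← NNReal.coe_mul, NNReal.mul_iInf, NNReal.coe_le_coe]
  refine le_ciInf fun l => ?_
  obtain ⟨f, rfl, rfl, h⟩ := exists_chain d l x y
  rw [h]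
  rcases Nat.eq_zero_or_pos l.length with h0 | h0
  · rw [h0]
    simp only [zero_add, Finset.sum_range_one]
    exact le_mul_of_one_le_left (zero_le) (by norm_num)
  · obtain ⟨n, hn⟩ : ∃ n, l.length = n + 1 := ⟨l.length - 1, by omega⟩
    rw [hn, ← NNReal.coe_le_coe]
    have := frink_chain hd f n 0
    simp only [zero_add] at this
    push_cast
    rw [show n + 1 + 1 = n + 2 by omega]
    have h1 := (d (f 0) (f 1)).coe_nonneg
    have h2 := (d (f (n + 1)) (f (n + 2))).coe_nonneg
    linarith

/-! ### Quasi-triangle constants, the index, and pseudometrics comparable to powers of ρ -/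

namespace IsQuasiMetric

variable {X : Type*} {ρ : X → X → ℝ}

theorem max_pos_of_not_eq (h : IsQuasiMetric ρ) {x y z : X} (hne : ¬ (x = y ∧ y = z)) :
    0 < max (ρ x z) (ρ z y) := by
  by_contra! hle
  have h1 := (h.eq_zero_iff x z).1 (le_antisymm ((le_max_left _ _).trans hle) (h.nonneg _ _))
  have h2 := (h.eq_zero_iff z y).1 (le_antisymm ((le_max_right _ _).trans hle) (h.nonneg _ _))
  exact hne ⟨h1.trans h2, h2.symm⟩

theorem bddAbove_qconst (h : IsQuasiMetric ρ) :
    BddAbove {t : ℝ | ∃ x y z : X, ¬ (x = y ∧ y = z) ∧ t = ρ x y / max (ρ x z) (ρ z y)} := by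
  obtain ⟨C, -, hC⟩ := h.quasi_subadd
  refine ⟨C, ?_⟩
  rintro _ ⟨x, y, z, hne, rfl⟩
  exact (div_le_iff₀ (h.max_pos_of_not_eq hne)).2 (hC x y z)

theorem le_qconst_mul (h : IsQuasiMetric ρ) (x y z : X) :
    ρ x y ≤ qconst ρ * max (ρ x z) (ρ z y) := by
  by_cases hne : x = y ∧ y = z
  · obtain ⟨rfl, rfl⟩ := hne
    simp [(h.eq_zero_iff x x).2 rfl]
  · exact (div_le_iff₀ (h.max_pos_of_not_eq hne)).1
      (le_csSup h.bddAbove_qconst ⟨x, y, z, hne, rfl⟩)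

theorem one_le_qconst [Nontrivial X] (h : IsQuasiMetric ρ) : 1 ≤ qconst ρ := by
  obtain ⟨x, y, hxy⟩ := exists_pair_ne X
  refine le_csSup h.bddAbove_qconst ⟨x, y, y, fun h' => hxy h'.1, ?_⟩
  have hpos : 0 < ρ x y := lt_of_le_of_ne (h.nonneg _ _) fun h0 => hxy ((h.eq_zero_iff x y).1 h0.symm)
  rw [(h.eq_zero_iff y y).2 rfl, max_eq_left hpos.le, div_self hpos.ne']

/-- A quasi-metric whose `t`-th power has quasi-triangle constant at most `2` is comparable to the
`1/t`-th power of a pseudometric. -/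
theorem exists_pseudoMetric (h : IsQuasiMetric ρ) {t : ℝ} (ht : 0 < t) (hC0 : 0 ≤ qconst ρ)
    (hC : qconst ρ ^ t ≤ 2) :
    ∃ D : PseudoMetricSpace X, ∃ c : ℝ, 0 < c ∧
      ∀ x y, ρ x y ^ t ≤ c * D.dist x y ∧ D.dist x y ≤ c * ρ x y ^ t := by
  -- Symmetrizing by the maximum keeps the constant `qconst ρ`, so the t-th power has constant at
  -- most 2 and Frink's lemma applies.
  set e : X → X → ℝ := fun x y => max (ρ x y) (ρ y x) with he
  have e_nonneg : ∀ x y, 0 ≤ e x y := fun x y => (h.nonneg x y).trans (le_max_left _ _)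
  set d : X → X → ℝ≥0 := fun x y => ⟨e x y ^ t, Real.rpow_nonneg (e_nonneg x y) t⟩ with hd
  have d_self : ∀ x, d x x = 0 := fun x => by
    refine NNReal.coe_injective (show e x x ^ t = 0 from ?_)
    simp [he, (h.eq_zero_iff x x).2 rfl, Real.zero_rpow ht.ne']
  have d_comm : ∀ x y, d x y = d y x := fun x y => by
    refine NNReal.coe_injective (show e x y ^ t = e y x ^ t from ?_)
    simp [he, max_comm]
  have e_tri : ∀ x y z, e x y ≤ qconst ρ * max (e x z) (e z y) := fun x y z => by
    refine max_le ((h.le_qconst_mul x y z).trans ?_) ((h.le_qconst_mul y x z).trans ?_)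
    · exact mul_le_mul_of_nonneg_left (max_le_max (le_max_left _ _) (le_max_left _ _)) hC0
    · rw [max_comm (e x z)]
      exact mul_le_mul_of_nonneg_left (max_le_max (le_max_right _ _) (le_max_right _ _)) hC0
  have d_tri : ∀ x y z, d x y ≤ 2 * max (d x z) (d z y) := fun x y z => by
    rw [← NNReal.coe_le_coe]
    push_cast
    change e x y ^ t ≤ 2 * max (e x z ^ t) (e z y ^ t)
    rw [← (Real.monotoneOn_rpow_Ici_of_exponent_nonneg ht.le).map_max (e_nonneg x z)
      (e_nonneg z y)]
    calc e x y ^ t ≤ (qconst ρ * max (e x z) (e z y)) ^ t :=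
          Real.rpow_le_rpow (e_nonneg x y) (e_tri x y z) ht.le
      _ = qconst ρ ^ t * max (e x z) (e z y) ^ t :=
          Real.mul_rpow hC0 ((e_nonneg x z).trans (le_max_left _ _))
      _ ≤ _ := by
          refine mul_le_mul_of_nonneg_right hC ?_
          exact Real.rpow_nonneg ((e_nonneg x z).trans (le_max_left _ _)) t
  obtain ⟨C₀, hC₀, hsymm⟩ := h.quasi_symm
  -- The 4 is Frink's loss; the other term is the cost of the symmetrization.
  refine ⟨PseudoMetricSpace.ofPreNNDist d d_self d_comm, max 4 (max 1 C₀ ^ t),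
    lt_max_of_lt_left (by norm_num), fun x y => ⟨?_, ?_⟩⟩
  · calc ρ x y ^ t ≤ e x y ^ t := Real.rpow_le_rpow (h.nonneg x y) (le_max_left _ _) ht.le
      _ ≤ _ := le_four_mul_dist_ofPreNNDist d d_self d_comm d_tri x y
      _ ≤ _ := mul_le_mul_of_nonneg_right (le_max_left _ _)
          (@dist_nonneg X (PseudoMetricSpace.ofPreNNDist d d_self d_comm) x y)
  · calc _ ≤ e x y ^ t := PseudoMetricSpace.dist_ofPreNNDist_le d d_self d_comm x y
      _ ≤ (max 1 C₀ * ρ x y) ^ t := by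
          refine Real.rpow_le_rpow (e_nonneg x y) (max_le ?_ ?_) ht.le
          · exact le_mul_of_one_le_left (h.nonneg x y) (le_max_left _ _)
          · exact (hsymm x y).trans (mul_le_mul_of_nonneg_right (le_max_right _ _) (h.nonneg x y))
      _ = max 1 C₀ ^ t * ρ x y ^ t :=
          Real.mul_rpow (zero_le_one.trans (le_max_left _ _)) (h.nonneg x y)
      _ ≤ _ := mul_le_mul_of_nonneg_right (le_max_right _ _) (Real.rpow_nonneg (h.nonneg x y) t)

end IsQuasiMetric

theorem qconst_rpow_le_two {X : Type*} {ρ : X → X → ℝ} {t : ℝ} (ht : 0 < t)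
    (hC : 1 ≤ qconst ρ) (h : ENNReal.ofReal t ≤ smoothnessExponent ρ) : qconst ρ ^ t ≤ 2 := by
  have hpos : 0 < qconst ρ := one_pos.trans_le hC
  have h1 : t * Real.logb 2 (qconst ρ) ≤ 1 := by
    rw [smoothnessExponent, ENNReal.le_inv_iff_mul_le, ← ENNReal.ofReal_mul ht.le,
      ← ENNReal.ofReal_one] at h
    exact (ENNReal.ofReal_le_ofReal_iff zero_le_one).1 h
  have h2 : Real.logb 2 (qconst ρ ^ t) ≤ Real.logb 2 2 := by
    rw [Real.logb_rpow_eq_mul_logb_of_pos hpos, Real.logb_self_eq_one one_lt_two]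
    exact h1
  exact (Real.logb_le_logb one_lt_two (Real.rpow_pos_of_pos hpos t) two_pos).1 h2

/-- If `s ⪯_q ind (X, ρ)` then some power `ρ ^ t` with `s < t` (or `s = t` when `q = ∞`) is
comparable to a pseudometric. -/
theorem LEIndex.exists_pseudoMetric {X : Type*} [Nontrivial X] {ρ : X → X → ℝ}
    (hρ : IsQuasiMetric ρ) {q : ℝ≥0∞} {s : ℝ} (hs : 0 < s) (h : LEIndex ρ q s) :
    ∃ t : ℝ, s ≤ t ∧ (s < t ∨ q = ∞) ∧ ∃ D : PseudoMetricSpace X, ∃ c : ℝ, 0 < c ∧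
      ∀ x y, ρ x y ^ t ≤ c * D.dist x y ∧ D.dist x y ≤ c * ρ x y ^ t := by
  obtain ⟨t, hst, hq, ϱ, hϱ, heq, hle⟩ : ∃ t : ℝ, s ≤ t ∧ (s < t ∨ q = ∞) ∧
      ∃ ϱ : X → X → ℝ, IsQuasiMetric ϱ ∧ Equivalent ϱ ρ ∧
        ENNReal.ofReal t ≤ smoothnessExponent ϱ := by
    -- At equality the supremum is attained, so t = s is admissible, and q = ∞. Below the index some
    -- competitor leaves room for t > s.
    rcases h.1.eq_or_lt with heq | hlt
    · obtain ⟨hq, ϱ, h1, h2, h3⟩ := h.2 heq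
      exact ⟨s, le_rfl, Or.inr hq, ϱ, h1, h2, heq.le.trans h3.ge⟩
    · obtain ⟨ϱ, hlt⟩ := lt_iSup_iff.1 hlt
      obtain ⟨⟨h1, h2⟩, hlt⟩ := lt_iSup_iff.1 hlt
      obtain ⟨t, ht0, h3, h4⟩ := ENNReal.lt_iff_exists_real_btwn.1 hlt
      have h5 : s < t := (ENNReal.ofReal_lt_ofReal_iff_of_nonneg hs.le).1 h3
      exact ⟨t, h5.le, Or.inl h5, ϱ, h1, h2, h4.le⟩
  have ht : 0 < t := hs.trans_le hst
  have h1 := hϱ.one_le_qconst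
  obtain ⟨D, c, hc, hD⟩ := hϱ.exists_pseudoMetric ht (zero_le_one.trans h1)
    (qconst_rpow_le_two ht h1 hle)
  obtain ⟨b, hb, hcomp⟩ := heq
  refine ⟨t, hst, hq, D, b ^ t * c, by positivity, fun x y => ⟨?_, ?_⟩⟩
  · calc ρ x y ^ t ≤ (b * ϱ x y) ^ t := by
          refine Real.rpow_le_rpow (hρ.nonneg x y) ?_ ht.le
          have := (hcomp x y).1
          rwa [inv_mul_le_iff₀ hb] at this
      _ = b ^ t * ϱ x y ^ t := Real.mul_rpow hb.le (hϱ.nonneg x y)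
      _ ≤ b ^ t * (c * D.dist x y) :=
          mul_le_mul_of_nonneg_left (hD x y).1 (Real.rpow_nonneg hb.le t)
      _ = _ := by ring
  · calc D.dist x y ≤ c * ϱ x y ^ t := (hD x y).2
      _ ≤ c * (b * ρ x y) ^ t := mul_le_mul_of_nonneg_left
          (Real.rpow_le_rpow (hϱ.nonneg x y) (hcomp x y).2 ht.le) hc.le
      _ = _ := by rw [Real.mul_rpow hb.le (hρ.nonneg x y)]; ring

/-! ### From fractional gradients to Hajłasz gradients -/

theorem le_lqNorm {q : ℝ≥0∞} (hq : 0 < q) (a : ℤ → ℝ≥0) (k : ℤ) : (a k : ℝ≥0∞) ≤ lqNorm q a := by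
  unfold lqNorm
  split_ifs with h
  · exact le_iSup (fun k => (a k : ℝ≥0∞)) k
  · have hq' : 0 < q.toReal := ENNReal.toReal_pos hq.ne' h
    calc (a k : ℝ≥0∞) = ((a k : ℝ≥0∞) ^ q.toReal) ^ (1 / q.toReal) := by
          rw [← ENNReal.rpow_mul, mul_one_div_cancel hq'.ne', ENNReal.rpow_one]
      _ ≤ _ := ENNReal.rpow_le_rpow (ENNReal.le_tsum k) (by positivity)

theorem aemeasurable_lqNorm {X : Type*} [MeasurableSpace X] {ν : Measure X} (q : ℝ≥0∞)
    {g : ℤ → X → ℝ≥0} (hg : ∀ k, AEMeasurable (g k) ν) :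
    AEMeasurable (fun x => lqNorm q fun k => g k x) ν := by
  unfold lqNorm
  split_ifs with h
  · exact AEMeasurable.iSup fun k => (hg k).coe_nnreal_ennreal
  · exact (AEMeasurable.tsum fun k =>
      (hg k).coe_nnreal_ennreal.pow_const _).pow_const _

section

variable {X : Type*} [MeasurableSpace X] {ρ : X → X → ℝ} {μ : Measure X}

theorem lintegral_le_of_mixedNorm_le {p : ℝ} (hp : 0 < p) {q : ℝ≥0∞} {E : Set X}
    {g : ℤ → X → ℝ≥0} {N : ℝ≥0∞} (h : mixedNorm μ p q E g ≤ N) :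
    ∫⁻ x in E, lqNorm q (fun k => g k x) ^ p ∂μ ≤ N ^ p := by
  have := ENNReal.rpow_le_rpow h hp.le
  rwa [mixedNorm, ← ENNReal.rpow_mul, one_div_mul_cancel hp.ne', ENNReal.rpow_one] at this

/-- The `ℓ^q` norm of a fractional gradient is a Hajłasz gradient. -/
theorem IsFracGradient.exists_hajlasz (hρ : IsQuasiMetric ρ) {s p : ℝ} (hs : 0 < s) (hp : 0 < p)
    {q : ℝ≥0∞} (hq : 0 < q) {E : Set X} (hE : NullMeasurableSet E μ) {u : X → ℝ}
    {g : ℤ → X → ℝ≥0} (hg : IsFracGradient ρ μ s E u g) (hfin : mixedNorm μ p q E g < ∞) :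
    ∃ N : Set X, μ N = 0 ∧ (∀ x ∈ E \ N, lqNorm q (fun k => g k x) < ∞) ∧
      ∀ x ∈ E \ N, ∀ y ∈ E \ N, |u x - u y| ≤ ρ x y ^ s *
        ((lqNorm q fun k => g k x).toReal + (lqNorm q fun k => g k y).toReal) := by
  obtain ⟨hmeas, N, hN, hgN⟩ := hg
  have hint := (lintegral_le_of_mixedNorm_le hp (le_refl (mixedNorm μ p q E g))).trans_lt
    (ENNReal.rpow_lt_top_of_nonneg hp.le hfin.ne)
  have hae := ae_lt_top' ((aemeasurable_lqNorm q hmeas).pow_const p) hint.ne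
  rw [ae_restrict_iff'₀ hE] at hae
  -- Points of infinite norm, null because the mixed norm is finite, are discarded too: there
  -- `toReal` would return 0 and monotonicity would fail.
  refine ⟨N ∪ {x | ¬ (x ∈ E → lqNorm q (fun k => g k x) ^ p < ∞)},
    measure_union_null hN hae, ?_, ?_⟩
  · rintro x ⟨hxE, hx⟩
    simp only [Set.mem_union, not_or, Set.mem_ofPred_eq, not_not] at hx
    exact (ENNReal.rpow_lt_top_iff_of_pos hp).1 (hx.2 hxE)
  · rintro x ⟨hxE, hx⟩ y ⟨hyE, hy⟩
    simp only [Set.mem_union, not_or, Set.mem_ofPred_eq, not_not] at hx hy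
    rcases (hρ.nonneg x y).eq_or_lt with h0 | hpos
    · rw [(hρ.eq_zero_iff x y).1 h0.symm, (hρ.eq_zero_iff y y).2 rfl, Real.zero_rpow hs.ne']
      simp
    · obtain ⟨n, hn1, hn2⟩ := exists_mem_Ico_zpow hpos one_lt_two
      have hfinx := (ENNReal.rpow_lt_top_iff_of_pos hp).1 (hx.2 hxE)
      have hfiny := (ENNReal.rpow_lt_top_iff_of_pos hp).1 (hy.2 hyE)
      have key := hgN (-(n + 1)) x ⟨hxE, hx.1⟩ y ⟨hyE, hy.1⟩
        (by rwa [show - -(n + 1) - 1 = n by ring]) (by rwa [neg_neg])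
      refine key.trans (mul_le_mul_of_nonneg_left (add_le_add ?_ ?_)
        (Real.rpow_nonneg hpos.le s))
      · exact (ENNReal.toReal_mono hfinx.ne (le_lqNorm hq (fun k => g k x) (-(n + 1))))
      · exact (ENNReal.toReal_mono hfiny.ne (le_lqNorm hq (fun k => g k y) (-(n + 1))))

/-- Some point outside any null set has G^p at most its mean over B. Such points replace ball
averages of u in the telescoping argument. The complement of B is added to the null set so that the
point lies in B. -/
theorem exists_rpow_le_div {E B N : Set X} (hBE : B ⊆ E) (hB0 : μ B ≠ 0) (hBfin : μ B < ∞)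
    (hB : NullMeasurableSet B μ) (hN : μ N = 0) {G : X → ℝ≥0∞}
    (hG : AEMeasurable G (μ.restrict E)) (p : ℝ) :
    ∃ y ∈ B \ N, G y ^ p ≤ (∫⁻ x in E, G x ^ p ∂μ) / μ B := by
  have : Fact (μ B < ∞) := ⟨hBfin⟩
  have h0 : μ.restrict B ≠ 0 := by rwa [Ne, Measure.restrict_eq_zero]
  have hnull : μ.restrict B (N ∪ Bᶜ) = 0 := by
    refine measure_union_null (le_antisymm ((Measure.restrict_apply_le _ _).trans hN.le) (zero_le))
      ?_
    rw [Measure.restrict_apply₀' hB, Set.compl_inter_self, measure_empty]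
  obtain ⟨y, hy, hle⟩ := exists_notMem_null_le_laverage h0
    ((hG.mono_measure (Measure.restrict_mono_set μ hBE)).pow_const p) hnull
  simp only [Set.mem_union, Set.mem_compl_iff, not_or, not_not] at hy
  refine ⟨y, ⟨hy.2, hy.1⟩, hle.trans ?_⟩
  rw [setLAverage_eq]
  exact ENNReal.div_le_div_right (lintegral_mono_set hBE) _

/-- Iterated doubling. -/
theorem measure_qball_two_pow_mul_le {C : ℝ}
    (hC : ∀ (x : X) (r : ℝ), 0 < r → μ (qball ρ x (2 * r)) ≤ ENNReal.ofReal C * μ (qball ρ x r))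
    (x : X) {r : ℝ} (hr : 0 < r) (n : ℕ) :
    μ (qball ρ x (2 ^ n * r)) ≤ ENNReal.ofReal C ^ n * μ (qball ρ x r) := by
  induction n with
  | zero => simp
  | succ n ih =>
    rw [pow_succ', mul_assoc, pow_succ', mul_assoc]
    exact (hC x _ (by positivity)).trans (by gcongr)

end

/-! ### Doubling implies exponential integrability -/

/-- Telescoping along a sequence converging geometrically to `x`. -/
theorem abs_sub_le_of_chain {X : Type*} {ρ : X → X → ℝ} (hρ : ∀ x y, 0 ≤ ρ x y) {u g : X → ℝ}
    {x : X} {y : ℕ → X} {s R κ T θ : ℝ} (hs : 0 < s) (hR : 0 < R) (hκ : 0 < κ)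
    (hT : 0 ≤ T) (hθ : 1 ≤ θ) (hθs : θ * (1 / 2) ^ s < 1) (hgx : 0 ≤ g x)
    (hx : ∀ i, ρ x (y i) ≤ R * (1 / 2) ^ i)
    (hy : ∀ i, ρ (y i) (y (i + 1)) ≤ κ * R * (1 / 2) ^ i)
    (hg0 : ∀ i, 0 ≤ g (y i)) (hg : ∀ i, g (y i) ≤ T * θ ^ i)
    (hux : ∀ i, |u x - u (y i)| ≤ ρ x (y i) ^ s * (g x + g (y i)))
    (huy : ∀ i, |u (y i) - u (y (i + 1))| ≤
      ρ (y i) (y (i + 1)) ^ s * (g (y i) + g (y (i + 1)))) :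
    |u x - u (y 0)| ≤ 2 * θ * κ ^ s / (1 - θ * (1 / 2) ^ s) * R ^ s * T := by
  have hθ0 : 0 < θ := one_pos.trans_le hθ
  have hpow : ∀ i : ℕ, (((1 : ℝ) / 2) ^ i) ^ s = (((1 : ℝ) / 2) ^ s) ^ i := fun i => by
    rw [← Real.rpow_natCast, ← Real.rpow_natCast, ← Real.rpow_mul (by norm_num),
      ← Real.rpow_mul (by norm_num), mul_comm]
  have hθi : ∀ i : ℕ, 1 ≤ θ ^ i := fun i => one_le_pow₀ hθ
  -- Convergence needs neither continuity nor Lebesgue points: the gradient inequality between x and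
  -- y_i, with g x a fixed real number, suffices.
  have hlim : Filter.Tendsto (fun i => u (y i)) Filter.atTop (nhds (u x)) := by
    have hle : ∀ i, dist (u (y i)) (u x) ≤ R ^ s * (g x + T) * (θ * (1 / 2) ^ s) ^ i := fun i => by
      rw [dist_comm, Real.dist_eq]
      calc _ ≤ ρ x (y i) ^ s * (g x + g (y i)) := hux i
        _ ≤ (R * (1 / 2) ^ i) ^ s * (g x * θ ^ i + T * θ ^ i) := by
            refine mul_le_mul (Real.rpow_le_rpow (hρ _ _) (hx i) hs.le)
              (add_le_add (le_mul_of_one_le_right hgx (hθi i)) (hg i))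
              (add_nonneg hgx (hg0 i)) (by positivity)
        _ = _ := by
            rw [Real.mul_rpow hR.le (by positivity), hpow, mul_pow]
            ring
    refine tendsto_iff_dist_tendsto_zero.2 (squeeze_zero (fun _ => dist_nonneg) hle ?_)
    have := (tendsto_pow_atTop_nhds_zero_of_lt_one (by positivity) hθs).const_mul
      (R ^ s * (g x + T))
    rwa [mul_zero] at this
  have hstep : ∀ i, dist (u (y i)) (u (y (i + 1))) ≤
      (2 * θ * κ ^ s * R ^ s * T) * (θ * (1 / 2) ^ s) ^ i := fun i => by
    rw [Real.dist_eq]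
    have h1 : g (y i) + g (y (i + 1)) ≤ 2 * (T * θ ^ (i + 1)) := by
      have h2 := hg i
      have h3 := hg (i + 1)
      have h4 : T * θ ^ i ≤ T * θ ^ (i + 1) :=
        mul_le_mul_of_nonneg_left (pow_le_pow_right₀ hθ (Nat.le_succ i)) hT
      linarith
    calc _ ≤ ρ (y i) (y (i + 1)) ^ s * (g (y i) + g (y (i + 1))) := huy i
      _ ≤ (κ * R * (1 / 2) ^ i) ^ s * (2 * (T * θ ^ (i + 1))) :=
          mul_le_mul (Real.rpow_le_rpow (hρ _ _) (hy i) hs.le) h1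
            (add_nonneg (hg0 _) (hg0 _)) (by positivity)
      _ = _ := by
          rw [Real.mul_rpow (by positivity) (by positivity), Real.mul_rpow hκ.le hR.le, hpow,
            mul_pow]
          ring
  have := dist_le_of_le_geometric_of_tendsto₀ _ _ hθs hstep hlim
  rw [dist_comm, Real.dist_eq] at this
  refine this.trans_eq ?_
  ring

/-- Here σ ≥ C_ρ is essential: small balls centred in B₀ stay in σB₀, where the gradient is defined.
-/
theorem IsQuasiMetric.qball_subset_mul {X : Type*} {ρ : X → X → ℝ} (hρ : IsQuasiMetric ρ)
    {σ : ℝ} (hσ : qconst ρ ≤ σ)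
    (hσ0 : 0 < σ) {x₀ x : X} {R r : ℝ} (hr : r ≤ R) (hx : x ∈ qball ρ x₀ R) :
    qball ρ x r ⊆ qball ρ x₀ (σ * R) := by
  intro y hy
  have hx' : ρ x₀ x < R := hx
  have hy' : ρ x y < R := lt_of_lt_of_le hy hr
  have hmax : 0 ≤ max (ρ x₀ x) (ρ x y) := (hρ.nonneg _ _).trans (le_max_left _ _)
  calc ρ x₀ y ≤ qconst ρ * max (ρ x₀ x) (ρ x y) := hρ.le_qconst_mul _ _ _
    _ ≤ σ * max (ρ x₀ x) (ρ x y) := mul_le_mul_of_nonneg_right hσ hmax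
    _ < σ * R := mul_lt_mul_of_pos_left (max_lt hx' hy') hσ0

section

variable {X : Type*} [MeasurableSpace X] {ρ : X → X → ℝ} {μ : Measure X}

/-- In a doubling space, functions with a gradient in `L^p`, `p` large, have bounded oscillation. -/
theorem IsDoubling.oscillation_le (hX : IsQuasiMetricMeasureSpace ρ μ) (hdoub : IsDoubling ρ μ)
    {σ : ℝ} (hσ : qconst ρ ≤ σ) {q : ℝ≥0∞} (hq : 0 < q) {s : ℝ} (hs : 0 < s) :
    ∃ p K : ℝ, 0 < p ∧ 0 < K ∧ ∀ (x₀ : X) (R : ℝ), 0 < R → ∀ (u : X → ℝ) (g : ℤ → X → ℝ≥0) (N : ℝ),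
      0 ≤ N → IsFracGradient ρ μ s (qball ρ x₀ (σ * R)) u g →
      mixedNorm μ p q (qball ρ x₀ (σ * R)) g ≤ ENNReal.ofReal N →
      ∃ Z : Set X, μ Z = 0 ∧ ∀ x ∈ qball ρ x₀ R \ Z, ∀ y ∈ qball ρ x₀ R \ Z,
        |u x - u y| ≤ K * (R ^ s * (N / μ.real (qball ρ x₀ (σ * R)) ^ (1 / p))) := by
  have hρ := hX.quasiMetric
  have := hX.nontrivial
  have hσ1 : 1 ≤ σ := hρ.one_le_qconst.trans hσ
  have hσ0 : 0 < σ := one_pos.trans_le hσ1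
  obtain ⟨C, hC1, hC⟩ : ∃ C : ℝ, 1 < C ∧ ∀ (x : X) (r : ℝ), 0 < r →
      μ (qball ρ x (2 * r)) ≤ ENNReal.ofReal C * μ (qball ρ x r) := by
    obtain ⟨C, -, hC⟩ := hdoub
    exact ⟨max C 2, lt_max_of_lt_right one_lt_two, fun x r hr => (hC x r hr).trans
      (by gcongr; exact le_max_left _ _)⟩
  have hC0 : 0 < C := one_pos.trans hC1
  obtain ⟨C₀, hC₀, hsymm⟩ := hρ.quasi_symm
  set κ : ℝ := σ * max C₀ 1 * σ with hκ
  have hκ0 : 0 < κ := by positivity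
  have hdist : ∀ {a b c : X} {r : ℝ}, 0 ≤ r → ρ a b ≤ σ * r → ρ a c ≤ σ * r → ρ b c ≤ κ * r := by
    intro a b c r hr hb hc
    have hmax : 0 ≤ max (ρ b a) (ρ a c) := (hρ.nonneg _ _).trans (le_max_left _ _)
    calc ρ b c ≤ qconst ρ * max (ρ b a) (ρ a c) := hρ.le_qconst_mul _ _ _
      _ ≤ σ * max (ρ b a) (ρ a c) := mul_le_mul_of_nonneg_right hσ hmax
      _ ≤ σ * (max C₀ 1 * (σ * r)) := by
          refine mul_le_mul_of_nonneg_left (max_le ?_ ?_) hσ0.le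
          · calc ρ b a ≤ C₀ * ρ a b := hsymm a b
              _ ≤ max C₀ 1 * (σ * r) := mul_le_mul (le_max_left _ _) hb (hρ.nonneg _ _)
                  (hC₀.le.trans (le_max_left _ _))
          · exact hc.trans (le_mul_of_one_le_left (by positivity) (le_max_right _ _))
      _ = _ := by rw [hκ]; ring
  -- The ball of radius 2^m R about any x in B₀ contains σB₀, so m doublings compare their measures.
  obtain ⟨m, hm⟩ := pow_unbounded_of_one_lt κ one_lt_two
  obtain ⟨p, hp, hθs⟩ : ∃ p : ℝ, 0 < p ∧ C ^ (1 / p) * (1 / 2) ^ s < 1 := by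
    have hlog : 0 < Real.logb 2 C := Real.logb_pos one_lt_two hC1
    -- Any p > log₂C / s would do; this one gives θ = 2^{s/2}, so the telescoping ratio is 2^{-s/2}.
    refine ⟨2 * Real.logb 2 C / s, by positivity, ?_⟩
    have h1 : C ^ (1 / (2 * Real.logb 2 C / s)) = (2 : ℝ) ^ (s / 2) := by
      nth_rewrite 1 [← Real.rpow_logb two_pos (by norm_num) hC0]
      rw [← Real.rpow_mul two_pos.le]
      congr 1
      field_simp
    rw [h1, one_div, Real.inv_rpow two_pos.le, ← Real.rpow_neg two_pos.le, ← Real.rpow_add two_pos]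
    exact Real.rpow_lt_one_of_one_lt_of_neg one_lt_two (by linarith)
  set θ : ℝ := C ^ (1 / p) with hθ
  have hθ1 : 1 ≤ θ := Real.one_le_rpow hC1.le (by positivity)
  set K₁ : ℝ := 2 * θ * κ ^ s / (1 - θ * (1 / 2) ^ s) with hK₁
  have hK₁0 : 0 < K₁ := div_pos (by positivity) (by linarith)
  -- Two telescoping chains cost K₁ each, joining their starting points costs 2κ^s, and θ^m is the
  -- factor in T.
  refine ⟨p, (2 * K₁ + 2 * κ ^ s) * θ ^ m, hp, by positivity, ?_⟩
  intro x₀ R hR u g N hN hg hnorm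
  set E := qball ρ x₀ (σ * R) with hE
  have hσR : 0 < σ * R := by positivity
  have hEmeas : NullMeasurableSet E μ := hX.nullMeasurableSet_ball _ _ hσR
  set V := μ.real E with hV
  have hEfin : μ E ≠ ∞ := (hX.measure_ball_lt_top x₀ _ hσR).ne
  have hV0 : 0 < V := ENNReal.toReal_pos (hX.measure_ball_pos x₀ _ hσR).ne' hEfin
  obtain ⟨Z, hZ, hfin, hu⟩ := hg.exists_hajlasz hρ hs hp hq hEmeas
    (hnorm.trans_lt ENNReal.ofReal_lt_top)
  set G : X → ℝ≥0∞ := fun x => lqNorm q fun k => g k x with hG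
  have hGint : ∫⁻ x in E, G x ^ p ∂μ ≤ ENNReal.ofReal N ^ p := lintegral_le_of_mixedNorm_le hp hnorm
  set T : ℝ := N / V ^ (1 / p) * θ ^ m with hT
  have hT0 : 0 ≤ T := by positivity
  have hsub : ∀ x ∈ qball ρ x₀ R, ∀ i : ℕ, qball ρ x (R * (1 / 2) ^ i) ⊆ E := fun x hx i =>
    hρ.qball_subset_mul hσ hσ0
      (mul_le_of_le_one_right hR.le (pow_le_one₀ (by norm_num) (by norm_num))) hx
  have hseq : ∀ x ∈ qball ρ x₀ R, ∀ i : ℕ, ∃ y ∈ qball ρ x (R * (1 / 2) ^ i) \ Z,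
      (G y).toReal ≤ T * θ ^ i := by
    intro x hx i
    have hri : 0 < R * (1 / 2) ^ i := by positivity
    obtain ⟨y, hy, hyG⟩ := exists_rpow_le_div (hsub x hx i)
      (hX.measure_ball_pos x _ hri).ne' (hX.measure_ball_lt_top x _ hri) (hX.nullMeasurableSet_ball x _ hri) hZ
      (aemeasurable_lqNorm q hg.1) p
    refine ⟨y, hy, ?_⟩
    have hlow : μ E ≤ ENNReal.ofReal C ^ (m + i) * μ (qball ρ x (R * (1 / 2) ^ i)) := by
      refine (measure_mono ?_).trans (measure_qball_two_pow_mul_le hC x hri (m + i))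
      intro z hz
      have h1 : ρ x z ≤ κ * R := hdist hR.le
        ((le_of_lt hx).trans (le_mul_of_one_le_left hR.le hσ1)) (le_of_lt hz)
      have h2 : (2 : ℝ) ^ (m + i) * (R * (1 / 2) ^ i) = 2 ^ m * R := by
        rw [pow_add, one_div, inv_pow]
        field_simp
      change ρ x z < _
      rw [h2]
      exact h1.trans_lt (mul_lt_mul_of_pos_right hm hR)
    have hdiv : G y ^ p ≤ ENNReal.ofReal (N ^ p * (C ^ (m + i) / V)) := by
      have hEV : μ E = ENNReal.ofReal V := (ENNReal.ofReal_toReal hEfin).symm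
      refine hyG.trans (ENNReal.div_le_of_le_mul ?_)
      calc _ ≤ ENNReal.ofReal N ^ p := hGint
        _ = ENNReal.ofReal (N ^ p * (C ^ (m + i) / V)) * (μ E / ENNReal.ofReal C ^ (m + i)) := by
            rw [hEV, ← ENNReal.ofReal_pow hC0.le, ← ENNReal.ofReal_div_of_pos (by positivity),
              ← ENNReal.ofReal_mul (by positivity), ENNReal.ofReal_rpow_of_nonneg hN hp.le]
            congr 1
            field_simp
        _ ≤ _ := by
            gcongr
            exact ENNReal.div_le_of_le_mul' hlow
    have hreal := ENNReal.toReal_mono ENNReal.ofReal_ne_top hdiv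
    rw [← ENNReal.toReal_rpow, ENNReal.toReal_ofReal (by positivity)] at hreal
    have hroot := Real.rpow_le_rpow (by positivity) hreal (show 0 ≤ 1 / p by positivity)
    rw [← Real.rpow_mul ENNReal.toReal_nonneg, mul_one_div_cancel hp.ne', Real.rpow_one] at hroot
    refine hroot.trans_eq ?_
    rw [Real.mul_rpow (by positivity) (by positivity), ← Real.rpow_mul hN,
      mul_one_div_cancel hp.ne', Real.rpow_one, Real.div_rpow (by positivity) hV0.le,
      ← Real.rpow_natCast, ← Real.rpow_mul hC0.le, mul_comm _ (1 / p), Real.rpow_mul hC0.le,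
      Real.rpow_natCast, hT, pow_add]
    ring
  have hnear : ∀ x ∈ qball ρ x₀ R \ Z, ∃ y ∈ E \ Z, (G y).toReal ≤ T ∧
      |u x - u y| ≤ K₁ * R ^ s * T := by
    rintro x ⟨hx, hxZ⟩
    choose y hy hyG using hseq x hx
    have hyE : ∀ i, y i ∈ E \ Z := fun i => ⟨hsub x hx i (hy i).1, (hy i).2⟩
    have hxE : x ∈ E \ Z :=
      ⟨lt_of_lt_of_le (show ρ x₀ x < R from hx) (le_mul_of_one_le_left hR.le hσ1), hxZ⟩
    refine ⟨y 0, hyE 0, by simpa using hyG 0, ?_⟩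
    have hxy : ∀ i, ρ x (y i) ≤ R * (1 / 2) ^ i := fun i => le_of_lt (hy i).1
    refine abs_sub_le_of_chain hρ.nonneg (g := fun x => (G x).toReal) hs hR hκ0 hT0 hθ1 hθs
      ENNReal.toReal_nonneg hxy (fun i => ?_) (fun _ => ENNReal.toReal_nonneg) hyG
      (fun i => hu _ hxE _ (hyE i)) (fun i => hu _ (hyE i) _ (hyE (i + 1)))
    rw [mul_assoc]
    have hri : 0 ≤ R * (1 / 2) ^ i := by positivity
    refine hdist hri ((hxy i).trans (le_mul_of_one_le_left hri hσ1)) ?_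
    refine (hxy (i + 1)).trans (le_trans ?_ (le_mul_of_one_le_left hri hσ1))
    exact mul_le_mul_of_nonneg_left
      (pow_le_pow_of_le_one (by norm_num) (by norm_num) (Nat.le_succ i)) hR.le
  refine ⟨Z, hZ, fun x hx y hy => ?_⟩
  obtain ⟨x', hx', hxT, hux⟩ := hnear x hx
  obtain ⟨y', hy', hyT, huy⟩ := hnear y hy
  have hmid : |u x' - u y'| ≤ κ ^ s * R ^ s * (T + T) := by
    rw [← Real.mul_rpow hκ0.le hR.le]
    refine (hu x' hx' y' hy').trans (mul_le_mul (Real.rpow_le_rpow (hρ.nonneg _ _) ?_ hs.le)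
      (add_le_add hxT hyT) (by positivity) (by positivity))
    exact hdist hR.le (le_of_lt hx'.1) (le_of_lt hy'.1)
  calc |u x - u y| ≤ |u x - u x'| + |u x' - u y'| + |u y - u y'| := by
        rw [abs_sub_comm (u y)]
        exact (abs_sub_le _ (u y') _).trans (by gcongr; exact abs_sub_le _ _ _)
    _ ≤ K₁ * R ^ s * T + κ ^ s * R ^ s * (T + T) + K₁ * R ^ s * T := by gcongr
    _ = _ := by rw [hT]; ring

/-- Doubling implies exponential integrability. -/
theorem IsDoubling.exp_integrable (hX : IsQuasiMetricMeasureSpace ρ μ) (hdoub : IsDoubling ρ μ)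
    {σ : ℝ} (hσ : qconst ρ ≤ σ) {q : ℝ≥0∞} (hq : 0 < q) {s : ℝ} (hs : 0 < s) :
    ∃ c₁ c₂ p ω : ℝ, 0 < c₁ ∧ 0 < c₂ ∧ 0 < p ∧ 0 < ω ∧
      ∀ (x₀ : X) (R₀ : ℝ), 0 < R₀ → ∀ u : X → ℝ,
        MemHTL ρ μ s p q (qball ρ x₀ (σ * R₀)) u →
        0 < htlNorm ρ μ s p q (qball ρ x₀ (σ * R₀)) u →
        IntegrableOn u (qball ρ x₀ R₀) μ ∧
        ⨍⁻ x in qball ρ x₀ R₀, ENNReal.ofReal (Real.exp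
          ((c₁ * (μ.real (qball ρ x₀ (σ * R₀)) ^ (1 / p) * |u x - ⨍ y in qball ρ x₀ R₀, u y ∂μ|) /
            (R₀ ^ s * (htlNorm ρ μ s p q (qball ρ x₀ (σ * R₀)) u).toReal)) ^ ω)) ∂μ
          ≤ ENNReal.ofReal c₂ := by
  obtain ⟨p, K, hp, hK, hosc⟩ := hdoub.oscillation_le hX hσ hq hs
  have := hX.nontrivial
  have hσ1 : 1 ≤ σ := hX.quasiMetric.one_le_qconst.trans hσ
  -- The 2 pays for a gradient within a factor 2 of the infimum; c₁ makes the exponent at most 1,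
  -- whence c₂ = e.
  refine ⟨1 / (2 * K), Real.exp 1, p, 1, by positivity, Real.exp_pos 1, hp, one_pos, ?_⟩
  rintro x₀ R hR u ⟨humeas, hfin⟩ hpos
  set E := qball ρ x₀ (σ * R) with hE
  set B := qball ρ x₀ R with hB
  have hσR : 0 < σ * R := by positivity
  have hEfin : μ E ≠ ∞ := (hX.measure_ball_lt_top x₀ _ hσR).ne
  have hV0 : 0 < μ.real E := ENNReal.toReal_pos (hX.measure_ball_pos x₀ _ hσR).ne' hEfin
  have hBmeas : NullMeasurableSet B μ := hX.nullMeasurableSet_ball x₀ R hR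
  have hBpos := hX.measure_ball_pos x₀ R hR
  have hBfin := hX.measure_ball_lt_top x₀ R hR
  have hBE : B ⊆ E := fun y hy => lt_of_lt_of_le hy (le_mul_of_one_le_left hR.le hσ1)
  set n := (htlNorm ρ μ s p q E u).toReal with hn
  have hn0 : 0 < n := ENNReal.toReal_pos hpos.ne' hfin.ne
  obtain ⟨g, hg, hgn⟩ : ∃ g, IsFracGradient ρ μ s E u g ∧
      mixedNorm μ p q E g ≤ ENNReal.ofReal (2 * n) := by
    have hlt : htlNorm ρ μ s p q E u < ENNReal.ofReal (2 * n) := by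
      rw [← ENNReal.ofReal_toReal hfin.ne]
      exact (ENNReal.ofReal_lt_ofReal_iff (by positivity)).2 (by linarith)
    obtain ⟨g, hlt⟩ := iInf_lt_iff.1 hlt
    obtain ⟨hg, hlt⟩ := iInf_lt_iff.1 hlt
    exact ⟨g, hg, hlt.le⟩
  obtain ⟨Z, hZ, hZu⟩ := hosc x₀ R hR u g (2 * n) (by positivity) hg hgn
  set M := K * (R ^ s * (2 * n / μ.real E ^ (1 / p))) with hM
  have hM0 : 0 < M := by positivity
  have haeZ : ∀ᵐ x ∂μ.restrict B, x ∈ B \ Z := by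
    have h1 : ∀ᵐ x ∂μ.restrict B, x ∉ Z := ae_restrict_of_ae (measure_eq_zero_iff_ae_notMem.1 hZ)
    filter_upwards [ae_restrict_mem₀ hBmeas, h1] with x h2 h3 using ⟨h2, h3⟩
  have hBfact : Fact (μ B < ∞) := ⟨hBfin⟩
  have hne : (ae (μ.restrict B)).NeBot := ae_neBot.2 (by
    rw [Ne, Measure.restrict_eq_zero]; exact hBpos.ne')
  obtain ⟨y, hy⟩ := haeZ.exists
  have hint : IntegrableOn u B μ := by
    refine Integrable.of_bound
      (humeas.mono_measure (Measure.restrict_mono_set μ hBE)).aestronglyMeasurable (|u y| + M) ?_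
    filter_upwards [haeZ] with x hx
    have h1 := hZu x hx y hy
    have h2 := abs_add_le (u x - u y) (u y)
    rw [sub_add_cancel] at h2
    rw [Real.norm_eq_abs]
    linarith
  refine ⟨hint, ?_⟩
  have hbound : ∀ᵐ x ∂μ.restrict B, ENNReal.ofReal (Real.exp
      ((1 / (2 * K) * (μ.real E ^ (1 / p) * |u x - ⨍ y in B, u y ∂μ|) /
            (R ^ s * n)) ^ (1 : ℝ))) ≤ ENNReal.ofReal (Real.exp 1) := by
    filter_upwards [haeZ] with x hx
    -- The mean lies in the closed convex ball that contains almost all values of u.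
    have hmem : (⨍ y in B, u y ∂μ) ∈ Metric.closedBall (u x) M := by
      refine (convex_closedBall (u x) M).set_average_mem Metric.isClosed_closedBall hBpos.ne'
        hBfin.ne ?_ hint
      filter_upwards [haeZ] with z hz
      exact hZu z hz x hx
    rw [Metric.mem_closedBall', Real.dist_eq] at hmem
    refine ENNReal.ofReal_le_ofReal (Real.exp_le_exp.2 ?_)
    rw [Real.rpow_one, div_le_one (by positivity)]
    calc _ ≤ 1 / (2 * K) * (μ.real E ^ (1 / p) * M) := by gcongr
      _ = _ := by rw [hM]; field_simp
  calc _ ≤ ⨍⁻ _ in B, ENNReal.ofReal (Real.exp 1) ∂μ := by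
        exact lintegral_mono_ae (Measure.ae_smul_measure hbound _)
    _ = _ := setLAverage_const hBpos.ne' hBfin.ne _

end

/-! ### Seminorms of Hölder cut-off functions -/

theorem lqNorm_mul_shift_le {q : ℝ≥0∞} (hq : 0 < q) (c : ℝ≥0) (b : ℤ → ℝ≥0) (k₀ : ℤ) :
    lqNorm q (fun k => c * b (k - k₀)) ≤ c * lqNorm q b := by
  unfold lqNorm
  split_ifs with h
  · refine iSup_le fun k => ?_
    push_cast
    gcongr
    exact le_iSup (fun k => (b k : ℝ≥0∞)) (k - k₀)
  · have hq' : 0 < q.toReal := ENNReal.toReal_pos hq.ne' h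
    push_cast
    simp_rw [ENNReal.mul_rpow_of_nonneg _ _ hq'.le]
    have hshift : ∑' k, (b (k - k₀) : ℝ≥0∞) ^ q.toReal = ∑' k, (b k : ℝ≥0∞) ^ q.toReal :=
      (Equiv.subRight k₀).tsum_eq fun k => (b k : ℝ≥0∞) ^ q.toReal
    rw [ENNReal.tsum_mul_left, hshift,
      ENNReal.mul_rpow_of_nonneg _ _ (by positivity), ← ENNReal.rpow_mul,
      mul_one_div_cancel hq'.ne', ENNReal.rpow_one]

/-- The model sequence `min (2^{(m+1)s}, 2^{t-m(t-s)})`. -/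
noncomputable def modelSeq (s t : ℝ) (m : ℤ) : ℝ≥0 :=
  min ((2 : ℝ≥0) ^ (((m : ℝ) + 1) * s)) ((2 : ℝ≥0) ^ (t - m * (t - s)))

/-- The terms decay geometrically as m → -∞ because s > 0, and as m → +∞ when s < t. For s = t the
right tail is only bounded, hence the restriction to q = ∞. -/
theorem lqNorm_modelSeq_lt_top {s t : ℝ} (hs : 0 < s) (hst : s ≤ t) {q : ℝ≥0∞} (hq : 0 < q)
    (hstq : s < t ∨ q = ∞) : lqNorm q (modelSeq s t) < ∞ := by
  have hneg : ∀ n : ℕ, modelSeq s t (-((n : ℤ) + 1)) ≤ (2 : ℝ≥0) ^ (-s * n) := fun n => by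
    refine (min_le_left _ _).trans_eq ?_
    congr 1
    push_cast
    ring
  have hpos : ∀ n : ℕ, modelSeq s t n ≤ (2 : ℝ≥0) ^ t * (2 : ℝ≥0) ^ (-(t - s) * n) := fun n => by
    refine (min_le_right _ _).trans_eq ?_
    rw [← NNReal.rpow_add two_ne_zero]
    congr 1
    push_cast
    ring
  unfold lqNorm
  split_ifs with h
  · refine lt_of_le_of_lt (iSup_le fun k => ENNReal.coe_le_coe.2 ?_)
      (ENNReal.coe_lt_top (r := (2 : ℝ≥0) ^ t))
    have ht : 1 ≤ (2 : ℝ≥0) ^ t := NNReal.one_le_rpow one_le_two (hs.le.trans hst)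
    rcases k with n | n
    · refine (hpos n).trans (mul_le_of_le_one_right (zero_le) ?_)
      refine NNReal.rpow_le_one_of_one_le_of_nonpos one_le_two ?_
      exact mul_nonpos_of_nonpos_of_nonneg (by linarith) n.cast_nonneg
    · rw [Int.negSucc_eq]
      refine (hneg n).trans (le_trans ?_ ht)
      refine NNReal.rpow_le_one_of_one_le_of_nonpos one_le_two ?_
      exact mul_nonpos_of_nonpos_of_nonneg (by linarith) n.cast_nonneg
  · have hst' : s < t := hstq.resolve_right h
    have hq' : 0 < q.toReal := ENNReal.toReal_pos hq.ne' h
    refine ENNReal.rpow_lt_top_of_nonneg (by positivity) ?_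
    simp_rw [← ENNReal.coe_rpow_of_nonneg _ hq'.le]
    rw [ENNReal.tsum_coe_ne_top_iff_summable, ← NNReal.summable_coe]
    have hgeo : ∀ e : ℝ, 0 < e →
        Summable fun n : ℕ => (((2 : ℝ≥0) ^ (-e * n)) ^ q.toReal : ℝ≥0) := fun e he => by
      have hlt : (2 : ℝ≥0) ^ (-e * q.toReal) < 1 :=
        NNReal.rpow_lt_one_of_one_lt_of_neg one_lt_two (by nlinarith)
      refine (NNReal.summable_geometric hlt).congr fun n => ?_
      rw [← NNReal.rpow_natCast, ← NNReal.rpow_mul, ← NNReal.rpow_mul]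
      congr 1
      ring
    refine Summable.of_nat_of_neg_add_one ?_ ?_
    · rw [NNReal.summable_coe (f := fun n : ℕ => modelSeq s t n ^ q.toReal)]
      refine NNReal.summable_of_le (fun n => ?_)
        ((hgeo (t - s) (by linarith)).mul_left (((2 : ℝ≥0) ^ t) ^ q.toReal))
      rw [← NNReal.mul_rpow]
      exact NNReal.rpow_le_rpow (hpos n) hq'.le
    · rw [NNReal.summable_coe (f := fun n : ℕ => modelSeq s t (-((n : ℤ) + 1)) ^ q.toReal)]
      exact NNReal.summable_of_le (fun n => NNReal.rpow_le_rpow (hneg n) hq'.le) (hgeo s hs)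

/-- Sequences dominating the difference quotients of truncated `t`-Hölder functions. -/
theorem exists_seq_lqNorm_le {s t : ℝ} (hs : 0 < s) (hst : s ≤ t) {q : ℝ≥0∞} (hq : 0 < q)
    (hstq : s < t ∨ q = ∞) :
    ∃ κ : ℝ, 0 < κ ∧ ∀ M : ℝ, 0 < M → ∃ a : ℤ → ℝ≥0,
      (∀ k : ℤ, ∀ r : ℝ, (2 : ℝ) ^ (-k - 1) ≤ r → r < (2 : ℝ) ^ (-k) →
        min 1 (M * r ^ t) ≤ r ^ s * a k) ∧
      lqNorm q a ≤ ENNReal.ofReal (κ * M ^ (s / t)) := by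
  have ht : 0 < t := hs.trans_le hst
  have hfin := lqNorm_modelSeq_lt_top hs hst hq hstq
  refine ⟨(lqNorm q (modelSeq s t)).toReal + 1, by positivity, fun M hM => ?_⟩
  -- The dyadic scale r ≈ 2^{-k₀} is where M r^t crosses 1. Shifting the model sequence there costs
  -- 2^{k₀s} ≤ M^{s/t}.
  obtain ⟨k₀, hk1, hk2⟩ := exists_mem_Ico_zpow (Real.rpow_pos_of_pos hM (1 / t)) one_lt_two
  have hMt : (M ^ (1 / t)) ^ t = M := by
    rw [← Real.rpow_mul hM.le, one_div_mul_cancel ht.ne', Real.rpow_one]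
  refine ⟨fun k => (2 : ℝ≥0) ^ (k₀ * s) * modelSeq s t (k - k₀), fun k r hr1 hr2 => ?_, ?_⟩
  · have hr : 0 < r := lt_of_lt_of_le (by positivity) hr1
    simp only [modelSeq, NNReal.coe_mul, NNReal.coe_min, NNReal.coe_rpow, NNReal.coe_ofNat]
    rw [mul_min_of_nonneg _ _ (by positivity), mul_min_of_nonneg _ _ (by positivity)]
    refine min_le_min ?_ ?_
    · have h1 : ((2 : ℝ) ^ (-k - 1)) ^ s ≤ r ^ s := Real.rpow_le_rpow (by positivity) hr1 hs.le
      rw [← Real.rpow_intCast, ← Real.rpow_mul two_pos.le] at h1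
      calc (1 : ℝ) = 2 ^ (((-k - 1 : ℤ) : ℝ) * s) *
            (2 ^ (k₀ * s) * 2 ^ ((((k - k₀ : ℤ) : ℝ) + 1) * s)) := by
            rw [← Real.rpow_add two_pos, ← Real.rpow_add two_pos]
            conv_lhs => rw [← Real.rpow_zero (2 : ℝ)]
            congr 1
            push_cast
            ring
        _ ≤ _ := mul_le_mul_of_nonneg_right h1 (by positivity)
    · have h1 : M ≤ 2 ^ (((k₀ + 1 : ℤ) : ℝ) * t) := by
        rw [Real.rpow_mul two_pos.le, Real.rpow_intCast]
        conv_lhs => rw [← hMt]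
        exact Real.rpow_le_rpow (by positivity) hk2.le ht.le
      have h2 : r ^ (t - s) ≤ 2 ^ (((-k : ℤ) : ℝ) * (t - s)) := by
        rw [Real.rpow_mul two_pos.le, Real.rpow_intCast]
        exact Real.rpow_le_rpow hr.le hr2.le (by linarith)
      calc M * r ^ t = r ^ s * (M * r ^ (t - s)) := by
            rw [show t = s + (t - s) by ring, Real.rpow_add hr, show s + (t - s) - s = t - s by ring]
            ring
        _ ≤ r ^ s * (2 ^ (((k₀ + 1 : ℤ) : ℝ) * t) * 2 ^ (((-k : ℤ) : ℝ) * (t - s))) := by gcongr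
        _ = _ := by
            rw [← Real.rpow_add two_pos, ← Real.rpow_add two_pos]
            congr 2
            push_cast
            ring
  · refine (lqNorm_mul_shift_le hq _ _ k₀).trans ?_
    have h1 : (2 : ℝ) ^ (k₀ * s) ≤ M ^ (s / t) := by
      rw [Real.rpow_mul two_pos.le, Real.rpow_intCast, show s / t = 1 / t * s by ring,
        Real.rpow_mul hM.le]
      exact Real.rpow_le_rpow (by positivity) hk1 hs.le
    have h2 : (((2 : ℝ≥0) ^ (k₀ * s) : ℝ≥0) : ℝ≥0∞) = ENNReal.ofReal ((2 : ℝ) ^ (k₀ * s)) := by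
      rw [← ENNReal.ofReal_coe_nnreal]
      simp
    rw [h2, ← ENNReal.ofReal_toReal hfin.ne, ← ENNReal.ofReal_mul (by positivity)]
    refine ENNReal.ofReal_le_ofReal ?_
    rw [mul_comm, ENNReal.toReal_ofReal ENNReal.toReal_nonneg]
    gcongr
    linarith

theorem lqNorm_zero {q : ℝ≥0∞} (hq : 0 < q) : lqNorm q 0 = 0 := by
  unfold lqNorm
  split_ifs with h
  · simp
  · have hq' : 0 < q.toReal := ENNReal.toReal_pos hq.ne' h
    simp [hq']

section

variable {X : Type*} [MeasurableSpace X] {ρ : X → X → ℝ} {μ : Measure X}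

/-- The semi-norm of a `t`-Hölder function with values in `[0, 1]` supported in `S`. -/
theorem htlNorm_le_of_holder {s t : ℝ} {q : ℝ≥0∞} (hq : 0 < q) {M : ℝ} {Q : ℝ≥0∞} {a : ℤ → ℝ≥0}
    (ha : ∀ k : ℤ, ∀ r : ℝ, (2 : ℝ) ^ (-k - 1) ≤ r → r < (2 : ℝ) ^ (-k) →
        min 1 (M * r ^ t) ≤ r ^ s * a k) (haQ : lqNorm q a ≤ Q) {p : ℝ} (hp : 0 < p)
    (hρ : ∀ x y, 0 ≤ ρ x y) {E S : Set X} (hS : MeasurableSet S) {u : X → ℝ}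
    (hu0 : ∀ x, 0 ≤ u x) (hu1 : ∀ x, u x ≤ 1) (huS : ∀ x, x ∉ S → u x = 0)
    (hu : ∀ x y, |u x - u y| ≤ M * ρ x y ^ t) :
    htlNorm ρ μ s p q E u ≤ Q * μ S ^ (1 / p) := by
  classical
  -- If u x ≠ u y, one of the points lies in S, and its single term a_k is enough.
  set g : ℤ → X → ℝ≥0 := fun k => S.indicator fun _ => a k with hg
  have hgrad : IsFracGradient ρ μ s E u g := by
    refine ⟨fun k => (measurable_const.indicator hS).aemeasurable, ∅, measure_empty, ?_⟩
    rintro k x - y - h1 h2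
    by_cases hxy : x ∈ S ∨ y ∈ S
    · have hone : |u x - u y| ≤ 1 := by
        rw [abs_le]
        constructor <;> linarith [hu0 x, hu1 x, hu0 y, hu1 y]
      refine (le_min hone (hu x y)).trans ((ha k _ h1 h2).trans ?_)
      refine mul_le_mul_of_nonneg_left ?_ (Real.rpow_nonneg (hρ x y) s)
      rcases hxy with h | h
      · simp only [hg, Set.indicator_of_mem h]
        exact le_add_of_nonneg_right (NNReal.coe_nonneg _)
      · simp only [hg, Set.indicator_of_mem h]
        exact le_add_of_nonneg_left (NNReal.coe_nonneg _)
    · rw [not_or] at hxy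
      rw [huS x hxy.1, huS y hxy.2, sub_zero, abs_zero]
      have := Real.rpow_nonneg (hρ x y) s
      positivity
  refine (iInf₂_le g hgrad).trans ?_
  have hpt : ∀ x, lqNorm q (fun k => g k x) ^ p ≤ S.indicator (fun _ => Q ^ p) x := fun x => by
    by_cases hx : x ∈ S
    · simp only [hg, Set.indicator_of_mem hx]
      exact ENNReal.rpow_le_rpow haQ hp.le
    · have h0 : (fun k => g k x) = 0 := by
        funext k
        simp [hg, Set.indicator_of_notMem hx]
      rw [h0, lqNorm_zero hq, ENNReal.zero_rpow_of_pos hp]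
      exact zero_le
  calc mixedNorm μ p q E g ≤ (Q ^ p * μ S) ^ (1 / p) := by
        refine ENNReal.rpow_le_rpow ?_ (by positivity)
        calc _ ≤ ∫⁻ x in E, S.indicator (fun _ => Q ^ p) x ∂μ := lintegral_mono hpt
          _ = Q ^ p * μ.restrict E S := lintegral_indicator_const hS _
          _ ≤ _ := mul_le_mul_right (Measure.restrict_apply_le _ _) _
    _ = _ := by
        rw [ENNReal.mul_rpow_of_nonneg _ _ (by positivity), ← ENNReal.rpow_mul,
          mul_one_div_cancel hp.ne', ENNReal.rpow_one]

/-- A function separating two sets of positive measure has positive semi-norm. -/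
theorem htlNorm_pos (hρ : IsQuasiMetric ρ) {s p : ℝ} (hs : 0 < s) (hp : 0 < p) {q : ℝ≥0∞}
    (hq : 0 < q) {E A A' : Set X} (hE : NullMeasurableSet E μ) (hA : NullMeasurableSet A μ)
    (hA' : NullMeasurableSet A' μ) (hAE : A ⊆ E) (hAE' : A' ⊆ E) (hApos : 0 < μ A)
    (hApos' : 0 < μ A') {P : ℝ} (hP : 0 < P) (hPE : ∀ x ∈ E, ∀ y ∈ E, ρ x y ≤ P) {u : X → ℝ}
    (huA : ∀ x ∈ A, u x = 1) (huA' : ∀ x ∈ A', u x = 0) :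
    0 < htlNorm ρ μ s p q E u := by
  set ε : ℝ := 1 / (2 * P ^ s) with hε
  have hε0 : 0 < ε := by positivity
  have hpos : 0 < (ENNReal.ofReal ε ^ p * min (μ A) (μ A')) ^ (1 / p) := by
    refine ENNReal.rpow_pos_of_nonneg (pos_iff_ne_zero.2 (mul_ne_zero ?_ ?_)) (by positivity)
    · exact (ENNReal.rpow_pos (ENNReal.ofReal_pos.2 hε0) ENNReal.ofReal_ne_top).ne'
    · exact (lt_min hApos hApos').ne'
  refine hpos.trans_le (le_iInf₂ fun g hg => ?_)
  rcases eq_or_ne (mixedNorm μ p q E g) ∞ with htop | htop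
  · rw [htop]; exact le_top
  obtain ⟨Z, hZ, hfin, hu⟩ := hg.exists_hajlasz hρ hs hp hq hE htop.lt_top
  refine ENNReal.rpow_le_rpow ?_ (by positivity)
  have hlow : ∀ F : Set X, NullMeasurableSet F μ → F ⊆ E →
      (∀ x ∈ F \ Z, ε ≤ (lqNorm q fun k => g k x).toReal) →
      ENNReal.ofReal ε ^ p * μ F ≤ ∫⁻ x in E, lqNorm q (fun k => g k x) ^ p ∂μ := by
    intro F hF hFE hFε
    refine le_trans ?_ (lintegral_mono_set hFE)
    rw [← setLIntegral_const]
    refine lintegral_mono_ae ?_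
    filter_upwards [ae_restrict_mem₀ hF, ae_restrict_of_ae (measure_eq_zero_iff_ae_notMem.1 hZ)]
      with x hx hxZ
    refine ENNReal.rpow_le_rpow ?_ hp.le
    rw [← ENNReal.ofReal_toReal (hfin x ⟨hFE hx, hxZ⟩).ne]
    exact ENNReal.ofReal_le_ofReal (hFε x ⟨hx, hxZ⟩)
  -- Since 2εP^s = 1, the gradient cannot be below ε at a point of A and at a point of A' at once:
  -- it is at least ε on all of one of them, off Z.
  by_cases hall : ∀ x ∈ A \ Z, ε ≤ (lqNorm q fun k => g k x).toReal
  · exact le_trans (by gcongr; exact min_le_left _ _) (hlow A hA hAE hall)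
  · push Not at hall
    obtain ⟨x, hx, hxε⟩ := hall
    refine le_trans (by gcongr; exact min_le_right _ _) (hlow A' hA' hAE' fun y hy => ?_)
    have h1 := hu x ⟨hAE hx.1, hx.2⟩ y ⟨hAE' hy.1, hy.2⟩
    rw [huA x hx.1, huA' y hy.1, sub_zero, abs_one] at h1
    by_contra! hyε
    have h2 : ρ x y ^ s ≤ P ^ s :=
      Real.rpow_le_rpow (hρ.nonneg _ _) (hPE _ (hAE hx.1) _ (hAE' hy.1)) hs.le
    have hPs : 0 < P ^ s := by positivity
    have h3 : P ^ s * (ε + ε) = 1 := by rw [hε]; field_simp; norm_num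
    have h4 : ρ x y ^ s * ((lqNorm q fun k => g k x).toReal + (lqNorm q fun k => g k y).toReal)
        ≤ P ^ s * ((lqNorm q fun k => g k x).toReal + (lqNorm q fun k => g k y).toReal) := by
      gcongr
    have h5 : P ^ s * ((lqNorm q fun k => g k x).toReal + (lqNorm q fun k => g k y).toReal)
        < P ^ s * (ε + ε) := mul_lt_mul_of_pos_left (add_lt_add hxε hyε) hPs
    linarith

/-! ### Decay of level sets and doubling -/

/-- One step of the iteration: exponential integrability applied to a cut-off function. -/
theorem measureReal_le_of_exp_integrable {c₁ c₂ p ω : ℝ} (hc₁ : 0 < c₁) (hc₂ : 0 < c₂) (hp : 0 < p)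
    (hω : 0 < ω) {B S S' : Set X} (hB : μ B ≠ ∞) (hB0 : 0 < μ.real B) (hS : MeasurableSet S)
    (hS' : MeasurableSet S') (hSS : S' ⊆ S) (hSB : S ⊆ B) (hS0 : 0 < μ.real S)
    (hhalf : μ.real S ≤ μ.real B / 2) {u : X → ℝ} (hu1 : ∀ x, u x ≤ 1)
    (huS : ∀ x, x ∉ S → u x = 0) (huS' : ∀ x ∈ S', u x = 1) (hint : IntegrableOn u B μ)
    {V W n H : ℝ} (hV : μ.real B ≤ V) (hW : 0 < W) (hn : 0 < n) (hH : 0 < H)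
    (hnH : n ≤ H * μ.real S ^ (1 / p))
    (hexp : ⨍⁻ x in B, ENNReal.ofReal (Real.exp
      ((c₁ * (V ^ (1 / p) * |u x - ⨍ y in B, u y ∂μ|) / (W * n)) ^ ω)) ∂μ ≤ ENNReal.ofReal c₂) :
    μ.real S' / μ.real B ≤
      c₂ * (2 * p / ω) ^ (2 * p / ω) * (2 * (W * H) / c₁) ^ (2 * p) *
        (μ.real S / μ.real B) ^ 2 := by
  set b := μ.real B with hb
  set z : ℝ := c₁ * (b / μ.real S) ^ (1 / p) / (2 * (W * H)) with hz
  set β : ℝ := 2 * p / ω with hβ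
  have hz0 : 0 < z := by positivity
  have hβ0 : 0 < β := by positivity
  have havg : ⨍ y in B, u y ∂μ ≤ 1 / 2 := by
    have h1 : ∫ y in B, u y ∂μ ≤ μ.real S := by
      calc ∫ y in B, u y ∂μ ≤ ∫ y in B, S.indicator (fun _ => (1 : ℝ)) y ∂μ := by
            refine integral_mono hint ?_ fun y => ?_
            · have : Fact (μ B < ∞) := ⟨hB.lt_top⟩
              exact (integrable_const _).indicator hS
            · by_cases hy : y ∈ S
              · rw [Set.indicator_of_mem hy]; exact hu1 y
              · rw [Set.indicator_of_notMem hy, huS y hy]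
        _ = μ.real S := by
            rw [integral_indicator_const _ hS, smul_eq_mul, mul_one, measureReal_def,
              Measure.restrict_apply hS, Set.inter_eq_left.2 hSB, measureReal_def]
    rw [setAverage_eq, smul_eq_mul, inv_mul_le_iff₀ hB0]
    linarith
  have hpt : ∀ x ∈ S', z ≤ c₁ * (V ^ (1 / p) * |u x - ⨍ y in B, u y ∂μ|) / (W * n) := by
    intro x hx
    have h1 : 1 / 2 ≤ |u x - ⨍ y in B, u y ∂μ| := by
      rw [huS' x hx]
      exact le_trans (by linarith) (le_abs_self _)
    have hS1 : 0 < μ.real S ^ (1 / p) := by positivity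
    have hV0 : 0 < V := hB0.trans_le hV
    calc z = c₁ * (b ^ (1 / p) * (1 / 2)) / (W * (H * μ.real S ^ (1 / p))) := by
          rw [hz, Real.div_rpow hB0.le hS0.le]
          field_simp
      _ ≤ _ := by gcongr
  -- From y ≤ e^y at y = z^ω/β, raised to the power β = 2p/ω. The power 2p turns the (1/p)-th power
  -- in z into a square, the gain that drives the iteration.
  have hexpz : z ^ (2 * p) / β ^ β ≤ Real.exp (z ^ ω) := by
    calc z ^ (2 * p) / β ^ β = (z ^ ω / β) ^ β := by
          rw [Real.div_rpow (by positivity) hβ0.le, ← Real.rpow_mul hz0.le,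
            show ω * β = 2 * p by rw [hβ]; field_simp]
      _ ≤ Real.exp (z ^ ω / β) ^ β := by
          refine Real.rpow_le_rpow (by positivity) ?_ hβ0.le
          linarith [Real.add_one_le_exp (z ^ ω / β)]
      _ = Real.exp (z ^ ω) := by
          rw [← Real.exp_mul, div_mul_cancel₀ _ hβ0.ne']
  have hlow : ENNReal.ofReal (z ^ (2 * p) / β ^ β * (μ.real S' / b)) ≤ ENNReal.ofReal c₂ := by
    refine le_trans ?_ hexp
    have hS'fin : μ S' ≠ ∞ := ((measure_mono (hSS.trans hSB)).trans_lt hB.lt_top).ne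
    rw [setLAverage_eq, ENNReal.ofReal_mul (by positivity), ENNReal.ofReal_div_of_pos hB0, hb,
      ofReal_measureReal hS'fin, ofReal_measureReal hB, ← mul_div_assoc]
    refine ENNReal.div_le_div_right ?_ _
    rw [← setLIntegral_const]
    refine le_trans ?_ (lintegral_mono_set (hSS.trans hSB))
    refine setLIntegral_mono' hS' fun x hx => ENNReal.ofReal_le_ofReal (hexpz.trans ?_)
    exact Real.exp_le_exp.2 (Real.rpow_le_rpow hz0.le (hpt x hx) hω.le)
  rw [ENNReal.ofReal_le_ofReal_iff hc₂.le] at hlow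
  have hz2 : z ^ (2 * p) = (b / μ.real S) ^ 2 / (2 * (W * H) / c₁) ^ (2 * p) := by
    rw [show z = (b / μ.real S) ^ (1 / p) / (2 * (W * H) / c₁) by rw [hz]; field_simp,
      Real.div_rpow (by positivity) (by positivity), ← Real.rpow_mul (by positivity),
      show 1 / p * (2 * p) = ((2 : ℕ) : ℝ) by push_cast; field_simp, Real.rpow_natCast]
  have hA0 : 0 < (2 * (W * H) / c₁) ^ (2 * p) := by positivity
  have hββ : 0 < β ^ β := by positivity
  rw [hz2] at hlow
  calc μ.real S' / b = ((b / μ.real S) ^ 2 / (2 * (W * H) / c₁) ^ (2 * p) / β ^ β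
          * (μ.real S' / b)) * (β ^ β * (2 * (W * H) / c₁) ^ (2 * p) * (μ.real S / b) ^ 2) := by
        generalize (2 * (W * H) / c₁) ^ (2 * p) = A at *
        generalize β ^ β = A' at *
        field_simp
    _ ≤ c₂ * (β ^ β * (2 * (W * H) / c₁) ^ (2 * p) * (μ.real S / b) ^ 2) := by gcongr
    _ = _ := by ring

end

/-- De Giorgi's fast convergence lemma: squaring δb^{-j} beats the growth b^j, and the smallness Kbδ
≤ 1 closes the induction. -/
theorem le_mul_pow_of_le_mul_sq {K b δ : ℝ} (hK : 0 ≤ K) (hb : 0 < b) (hδ : K * b * δ ≤ 1)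
    {a : ℕ → ℝ} (ha : ∀ j, 0 ≤ a j) (h0 : a 0 ≤ δ)
    (hstep : ∀ j, a (j + 1) ≤ K * b ^ j * a j ^ 2) (j : ℕ) : a j ≤ δ * (1 / b) ^ j := by
  have hδ0 : 0 ≤ δ := (ha 0).trans h0
  induction j with
  | zero => simpa using h0
  | succ j ih =>
    calc a (j + 1) ≤ K * b ^ j * a j ^ 2 := hstep j
      _ ≤ K * b ^ j * (δ * (1 / b) ^ j) ^ 2 := by
          have := ha j
          gcongr
      _ = (K * b * δ) * (δ * (1 / b) ^ (j + 1)) := by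
          rw [one_div, inv_pow, inv_pow]
          field_simp
          ring
      _ ≤ _ := mul_le_of_le_one_left (by positivity) hδ

/-- Sublevel sets of f contain a ρ-ball about each of their points, so they are open for `qtopology
ρ`, whereas ρ-balls themselves need not be. Level sets therefore serve as the test sets. -/
theorem measurable_of_holder {X : Type*} [m : MeasurableSpace X] {ρ : X → X → ℝ}
    (hρ : ∀ x y, 0 ≤ ρ x y)
    (hborel : @borel X (qtopology ρ) ≤ m) {t c : ℝ} (ht : 0 < t) (hc : 0 < c) {f : X → ℝ}
    (hf : ∀ x y, |f x - f y| ≤ c * ρ x y ^ t) : Measurable f := by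
  refine measurable_of_Iio fun a => hborel _ (MeasurableSpace.measurableSet_generateFrom ?_)
  intro x hx
  have hx' : 0 < a - f x := sub_pos.2 hx
  refine ⟨((a - f x) / c) ^ (1 / t), by positivity, fun y hy => ?_⟩
  have hlt : ρ x y ^ t < (a - f x) / c := by
    have := Real.rpow_lt_rpow (hρ x y) (show ρ x y < _ from hy) ht
    rwa [← Real.rpow_mul (by positivity), one_div_mul_cancel ht.ne', Real.rpow_one] at this
  rw [lt_div_iff₀ hc] at hlt
  have h1 := (neg_abs_le _).trans' (neg_le_neg (hf x y))
  change f y < a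
  linarith

/-- The piecewise linear cut-off function, `1` on `[0, v]` and `0` on `[w, ∞)`. -/
noncomputable def cutoff (v w x : ℝ) : ℝ := max (min ((w - x) / (w - v)) 1) 0

theorem cutoff_nonneg (v w x : ℝ) : 0 ≤ cutoff v w x := le_max_right _ _

theorem cutoff_le_one (v w x : ℝ) : cutoff v w x ≤ 1 := max_le (min_le_right _ _) zero_le_one

theorem cutoff_eq_one {v w x : ℝ} (h : v < w) (hx : x ≤ v) : cutoff v w x = 1 := by
  have h1 : 1 ≤ (w - x) / (w - v) := (one_le_div (by linarith)).2 (by linarith)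
  rw [cutoff, min_eq_right h1, max_eq_left zero_le_one]

theorem cutoff_eq_zero {v w x : ℝ} (h : v < w) (hx : w ≤ x) : cutoff v w x = 0 :=
  max_eq_right ((min_le_left _ _).trans
    (div_nonpos_of_nonpos_of_nonneg (by linarith) (by linarith)))

theorem abs_cutoff_sub_le {v w : ℝ} (h : v < w) (x y : ℝ) :
    |cutoff v w x - cutoff v w y| ≤ |x - y| / (w - v) := by
  have h0 : 0 < w - v := sub_pos.2 h
  calc |cutoff v w x - cutoff v w y|
      ≤ |min ((w - x) / (w - v)) 1 - min ((w - y) / (w - v)) 1| := abs_max_sub_max_le_abs _ _ _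
    _ ≤ |(w - x) / (w - v) - (w - y) / (w - v)| := abs_inf_sub_inf_le_abs _ _ _
    _ = |x - y| / (w - v) := by
        rw [← sub_div, abs_div, abs_of_pos h0, abs_sub_comm]
        congr 2
        ring

theorem measurable_cutoff (v w : ℝ) : Measurable (cutoff v w) := by
  unfold cutoff
  fun_prop

theorem IsQuasiMetric.exists_bound_qball {X : Type*} {ρ : X → X → ℝ} (hρ : IsQuasiMetric ρ) (x₀ : X) (R : ℝ) :
    ∃ P : ℝ, 0 < P ∧ ∀ x ∈ qball ρ x₀ R, ∀ y ∈ qball ρ x₀ R, ρ x y ≤ P := by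
  obtain ⟨C₀, hC₀, hsymm⟩ := hρ.quasi_symm
  obtain ⟨C₁, hC₁, hsub⟩ := hρ.quasi_subadd
  refine ⟨max (C₁ * max (C₀ * R) R) 1, lt_max_of_lt_right one_pos, fun x hx y hy => ?_⟩
  refine (hsub x y x₀).trans (le_trans ?_ (le_max_left _ _))
  refine mul_le_mul_of_nonneg_left (max_le_max ((hsymm x₀ x).trans ?_) (le_of_lt hy)) hC₁.le
  exact mul_le_mul_of_nonneg_left (le_of_lt hx) hC₀.le

section

variable {X : Type*} [MeasurableSpace X] {ρ : X → X → ℝ} {μ : Measure X}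

/-- Exponential integrability implies doubling. -/
theorem isDoubling_of_exp_integrable (hX : IsQuasiMetricMeasureSpace ρ μ)
    {σ : ℝ} (hσ : qconst ρ ≤ σ) {q : ℝ≥0∞} (hq : 0 < q) {s : ℝ} (hs : 0 < s)
    (hind : LEIndex ρ q s) {c₁ c₂ p ω : ℝ} (hc₁ : 0 < c₁) (hc₂ : 0 < c₂) (hp : 0 < p) (hω : 0 < ω)
    (hexp : ∀ (x₀ : X) (R₀ : ℝ), 0 < R₀ → ∀ u : X → ℝ,
        MemHTL ρ μ s p q (qball ρ x₀ (σ * R₀)) u →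
        0 < htlNorm ρ μ s p q (qball ρ x₀ (σ * R₀)) u →
        IntegrableOn u (qball ρ x₀ R₀) μ ∧
        ⨍⁻ x in qball ρ x₀ R₀, ENNReal.ofReal (Real.exp
          ((c₁ * (μ.real (qball ρ x₀ (σ * R₀)) ^ (1 / p) * |u x - ⨍ y in qball ρ x₀ R₀, u y ∂μ|) /
            (R₀ ^ s * (htlNorm ρ μ s p q (qball ρ x₀ (σ * R₀)) u).toReal)) ^ ω)) ∂μ
          ≤ ENNReal.ofReal c₂) :
    IsDoubling ρ μ := by
  have hρ := hX.quasiMetric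
  have := hX.nontrivial
  have hσ1 : 1 ≤ σ := hρ.one_le_qconst.trans hσ
  obtain ⟨t, hst, hstq, D, c, hc, hD⟩ := hind.exists_pseudoMetric hρ hs
  have ht : 0 < t := hs.trans_le hst
  obtain ⟨κ, hκ, hseq⟩ := exists_seq_lqNorm_le hs hst hq hstq
  set A : ℝ := κ * (4 * c ^ 2) ^ (s / t) * 2 ^ s with hA
  have hA0 : 0 < A := by positivity
  set K : ℝ := c₂ * (2 * p / ω) ^ (2 * p / ω) * (2 * A / c₁) ^ (2 * p) with hK
  have hK0 : 0 < K := by positivity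
  set b : ℝ := 2 ^ (s / t * (2 * p)) with hb
  have hb1 : 1 < b := Real.one_lt_rpow one_lt_two (by positivity)
  have hb0 : 0 < b := one_pos.trans hb1
  -- 1/2 keeps each S_j within half of B, so the cut-offs have mean at most 1/2; 1/(Kb) is the
  -- smallness that the iteration needs.
  set δ : ℝ := min (1 / 2) (1 / (K * b)) with hδ
  have hδ0 : 0 < δ := by positivity
  have hδK : K * b * δ ≤ 1 := by
    calc K * b * δ ≤ K * b * (1 / (K * b)) := by gcongr; exact min_le_right _ _
      _ = 1 := by field_simp
  refine ⟨1 / δ, by positivity, fun x₀ r hr => ?_⟩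
  set B := qball ρ x₀ (2 * r) with hB
  set E := qball ρ x₀ (σ * (2 * r)) with hE
  have hr2 : 0 < 2 * r := by positivity
  have hσr : 0 < σ * (2 * r) := by positivity
  have hBfin : μ B ≠ ∞ := (hX.measure_ball_lt_top x₀ _ hr2).ne
  have hEfin : μ E ≠ ∞ := (hX.measure_ball_lt_top x₀ _ hσr).ne
  have hBmeas : NullMeasurableSet B μ := hX.nullMeasurableSet_ball x₀ _ hr2
  have hB0 : 0 < μ.real B := ENNReal.toReal_pos (hX.measure_ball_pos x₀ _ hr2).ne' hBfin
  have hBE : B ⊆ E := fun y hy => lt_of_lt_of_le hy (le_mul_of_one_le_left hr2.le hσ1)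
  set f : X → ℝ := fun y => D.dist x₀ y with hf
  have hfρ : ∀ x y, |f x - f y| ≤ c * ρ x y ^ t := fun x y => by
    refine le_trans ?_ (hD x y).2
    have := @abs_dist_sub_le X D x y x₀
    rwa [@dist_comm X D x, @dist_comm X D y] at this
  have hfmeas : Measurable f := measurable_of_holder hρ.nonneg hX.borel_le ht hc hfρ
  have hlev : ∀ a : ℝ, MeasurableSet {y | f y < a} := fun a => measurableSet_lt hfmeas measurable_const
  set τ : ℝ := r ^ t / c with hτ
  have hτ0 : 0 < τ := by positivity
  -- The levels fall from τ, where f < τ forces ρ x₀ y < r, towards τ/2, so that a fixed ball lies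
  -- in every S_j.
  set v : ℕ → ℝ := fun j => τ * (1 / 2 + (1 / 2) ^ (j + 1)) with hv
  have hvstep : ∀ j, v j - v (j + 1) = τ * (1 / 2) ^ (j + 2) := fun j => by
    simp only [hv]
    ring
  have hvlt : ∀ j, v (j + 1) < v j := fun j => by
    have : 0 < τ * (1 / 2) ^ (j + 2) := by positivity
    linarith [hvstep j]
  have hvle : ∀ j, v j ≤ τ := fun j => by
    have : ((1 : ℝ) / 2) ^ (j + 1) ≤ 1 / 2 := by
      rw [pow_succ]
      exact mul_le_of_le_one_left (by norm_num) (pow_le_one₀ (by norm_num) (by norm_num))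
    calc v j ≤ τ * (1 / 2 + 1 / 2) := by simp only [hv]; gcongr
      _ = τ := by ring
  have hvge : ∀ j, τ / 2 ≤ v j := fun j => by
    have : 0 < τ * (1 / 2) ^ (j + 1) := by positivity
    simp only [hv]
    linarith
  set S : ℕ → Set X := fun j => {y | f y < v j} with hS
  have hSmeas : ∀ j, MeasurableSet (S j) := fun j => hlev _
  have hSball : ∀ j, S j ⊆ qball ρ x₀ r := fun j y hy => by
    have h1 : f y < τ := lt_of_lt_of_le hy (hvle j)
    have h2 : ρ x₀ y ^ t < r ^ t := by
      calc ρ x₀ y ^ t ≤ c * f y := (hD x₀ y).1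
        _ < c * τ := by gcongr
        _ = r ^ t := by rw [hτ]; field_simp
    exact (Real.rpow_lt_rpow_iff (hρ.nonneg _ _) hr.le ht).1 h2
  have hSB : ∀ j, S j ⊆ B := fun j y hy =>
    lt_trans (show ρ x₀ y < r from hSball j hy) (by linarith)
  have hSfin : ∀ j, μ (S j) ≠ ∞ := fun j => ((measure_mono (hSB j)).trans_lt hBfin.lt_top).ne
  obtain ⟨η, hη, hηS⟩ : ∃ η : ℝ, 0 < η ∧ ∀ j, η ≤ μ.real (S j) := by
    set r' : ℝ := (τ / (2 * c)) ^ (1 / t) with hr'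
    have hr'0 : 0 < r' := by positivity
    have hfin' := hX.measure_ball_lt_top x₀ r' hr'0
    refine ⟨μ.real (qball ρ x₀ r'),
      ENNReal.toReal_pos (hX.measure_ball_pos x₀ r' hr'0).ne' hfin'.ne, fun j => ?_⟩
    refine measureReal_mono (fun y hy => ?_) (hSfin j)
    have h1 := Real.rpow_lt_rpow (hρ.nonneg x₀ y) (show ρ x₀ y < r' from hy) ht
    rw [hr', ← Real.rpow_mul (by positivity), one_div_mul_cancel ht.ne', Real.rpow_one,
      lt_div_iff₀ (by positivity)] at h1
    have h2 : f y ≤ c * ρ x₀ y ^ t := (hD x₀ y).2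
    have h3 := hvge j
    change f y < v j
    linarith
  have hSanti : ∀ j, S (j + 1) ⊆ S j := fun j y hy => lt_trans (show f y < _ from hy) (hvlt j)
  have hSanti0 : ∀ j, S j ⊆ S 0 := fun j => by
    induction j with
    | zero => exact subset_rfl
    | succ j ih => exact (hSanti j).trans ih
  suffices hlarge : δ * μ.real B ≤ μ.real (S 0) by
    calc μ B = ENNReal.ofReal (1 / δ * (δ * μ.real B)) := by
          rw [← mul_assoc, one_div_mul_cancel hδ0.ne', one_mul, ofReal_measureReal hBfin]
      _ ≤ ENNReal.ofReal (1 / δ * μ.real (S 0)) := by gcongr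
      _ = ENNReal.ofReal (1 / δ) * μ (S 0) := by
          rw [ENNReal.ofReal_mul (by positivity), ofReal_measureReal (hSfin 0)]
      _ ≤ _ := by gcongr; exact hSball 0
  by_contra! hsmall
  have ha0 : μ.real (S 0) / μ.real B ≤ δ := (div_le_iff₀ hB0).2 hsmall.le
  have hhalf : ∀ j, μ.real (S j) ≤ μ.real B / 2 := fun j => by
    have h1 : μ.real (S j) ≤ μ.real (S 0) := measureReal_mono (hSanti0 j) (hSfin 0)
    have h2 : δ * μ.real B ≤ 1 / 2 * μ.real B := by gcongr; exact min_le_left _ _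
    linarith
  obtain ⟨P, hP, hPE⟩ := hρ.exists_bound_qball x₀ (σ * (2 * r))
  have hstep : ∀ j, μ.real (S (j + 1)) / μ.real B ≤ K * b ^ j * (μ.real (S j) / μ.real B) ^ 2 := by
    intro j
    set u : X → ℝ := fun y => cutoff (v (j + 1)) (v j) (f y) with hu
    have humeas : Measurable u := (measurable_cutoff _ _).comp hfmeas
    set M : ℝ := c / (v j - v (j + 1)) with hM
    have hgap : 0 < v j - v (j + 1) := sub_pos.2 (hvlt j)
    have hM0 : 0 < M := by positivity
    have huρ : ∀ x y, |u x - u y| ≤ M * ρ x y ^ t := fun x y => by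
      refine (abs_cutoff_sub_le (hvlt j) _ _).trans ?_
      rw [hM, div_mul_eq_mul_div]
      exact div_le_div_of_nonneg_right (hfρ x y) hgap.le
    have huS : ∀ x, x ∉ S j → u x = 0 := fun x hx => cutoff_eq_zero (hvlt j) (not_lt.1 hx)
    have huS' : ∀ x ∈ S (j + 1), u x = 1 := fun x hx =>
      cutoff_eq_one (hvlt j) (le_of_lt (show f x < _ from hx))
    obtain ⟨a, ha, haQ⟩ := hseq M hM0
    have hnorm := htlNorm_le_of_holder (μ := μ) (E := E) hq ha haQ hp hρ.nonneg (hSmeas j)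
      (fun x => cutoff_nonneg _ _ (f x)) (fun x => cutoff_le_one _ _ (f x)) huS huρ
    have hrhs : ENNReal.ofReal (κ * M ^ (s / t)) * μ (S j) ^ (1 / p) =
        ENNReal.ofReal (κ * M ^ (s / t) * μ.real (S j) ^ (1 / p)) := by
      rw [ENNReal.ofReal_mul (p := κ * M ^ (s / t)) (by positivity), ← ofReal_measureReal (hSfin j),
        ENNReal.ofReal_rpow_of_nonneg measureReal_nonneg (by positivity)]
    rw [hrhs] at hnorm
    have hnfin : htlNorm ρ μ s p q E u < ∞ := hnorm.trans_lt ENNReal.ofReal_lt_top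
    have hSpos : ∀ i, 0 < μ.real (S i) := fun i => hη.trans_le (hηS i)
    -- Statement (b) only concerns u of positive seminorm: u is 1 on S_{j+1} and 0 on B \ S_j, and
    -- both have positive measure.
    have hnpos : 0 < htlNorm ρ μ s p q E u := by
      refine htlNorm_pos hρ hs hp hq (hX.nullMeasurableSet_ball x₀ _ hσr)
        (hSmeas (j + 1)).nullMeasurableSet (hBmeas.diff (hSmeas j).nullMeasurableSet)
        ((hSB _).trans hBE) (Set.sdiff_subset.trans hBE) ?_ ?_ hP hPE huS' (fun x hx => huS x hx.2)
      · exact (ENNReal.toReal_pos_iff.1 (hSpos (j + 1))).1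
      · have h1 : 0 < μ.real (B \ S j) := by
          have h2 := measureReal_sdiff_add_inter (s := B) (hSmeas j) hBfin
          rw [Set.inter_eq_right.2 (hSB j)] at h2
          linarith [hhalf j]
        exact (ENNReal.toReal_pos_iff.1 h1).1
    obtain ⟨hint, hle⟩ := hexp x₀ (2 * r) hr2 u ⟨humeas.aemeasurable, hnfin⟩ hnpos
    have key := measureReal_le_of_exp_integrable hc₁ hc₂ hp hω hBfin hB0 (hSmeas j)
      (hSmeas (j + 1)) (hSanti j) (hSB j) (hSpos j) (hhalf j) (fun x => cutoff_le_one _ _ (f x))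
      huS huS' hint (measureReal_mono hBE hEfin) (show 0 < (2 * r) ^ s by positivity)
      (ENNReal.toReal_pos hnpos.ne' hnfin.ne) (show 0 < κ * M ^ (s / t) by positivity)
      (ENNReal.toReal_le_of_le_ofReal (by positivity) hnorm) hle
    refine key.trans_eq ?_
    -- The radius cancels: M is of order 2^j r^{-t}, so M^{s/t} contributes r^{-s} and only 2^{js/t}
    -- remains, which becomes b^j after the power 2p.
    have hWH : (2 * r) ^ s * (κ * M ^ (s / t)) = A * 2 ^ (s / t * j) := by
      have hMeq : M = 4 * c ^ 2 * 2 ^ (j : ℝ) * (r ^ t)⁻¹ := by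
        rw [hM, hvstep, hτ, Real.rpow_natCast, one_div, inv_pow, pow_add]
        field_simp
        norm_num
      have hrs : ((r ^ t)⁻¹) ^ (s / t) = (r ^ s)⁻¹ := by
        rw [Real.inv_rpow (by positivity), ← Real.rpow_mul hr.le, mul_div_cancel₀ _ ht.ne']
      rw [hMeq, Real.mul_rpow two_pos.le hr.le, Real.mul_rpow (by positivity) (by positivity), hrs,
        Real.mul_rpow (by positivity) (by positivity), ← Real.rpow_mul two_pos.le, hA, mul_comm (j : ℝ)]
      field_simp
    have hpow : (2 * ((2 * r) ^ s * (κ * M ^ (s / t))) / c₁) ^ (2 * p) =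
        (2 * A / c₁) ^ (2 * p) * b ^ j := by
      rw [hWH, show 2 * (A * 2 ^ (s / t * j)) / c₁ = 2 * A / c₁ * 2 ^ (s / t * j) by ring,
        Real.mul_rpow (by positivity) (by positivity), hb, ← Real.rpow_natCast,
        ← Real.rpow_mul two_pos.le, ← Real.rpow_mul two_pos.le]
      congr 2
      ring
    rw [hpow, hK]
    ring
  have hdecay := le_mul_pow_of_le_mul_sq hK0.le hb0 hδK
    (a := fun j => μ.real (S j) / μ.real B) (fun j => by positivity) ha0 hstep
  have hlim : Filter.Tendsto (fun j : ℕ => δ * (1 / b) ^ j) Filter.atTop (nhds 0) := by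
    have := (tendsto_pow_atTop_nhds_zero_of_lt_one (by positivity)
      ((div_lt_one hb0).2 hb1)).const_mul δ
    rwa [mul_zero] at this
  have hle0 : η / μ.real B ≤ 0 := ge_of_tendsto' hlim fun j =>
    (div_le_div_of_nonneg_right (hηS j) hB0.le).trans (hdecay j)
  exact absurd (div_pos hη hB0) (not_lt.2 hle0)

end

end QuasiMetric

theorem mainTheorem7 {X : Type*} [MeasurableSpace X] (ρ : X → X → ℝ) (μ : Measure X)
    (hX : QuasiMetric.IsQuasiMetricMeasureSpace ρ μ)
    (hperf : QuasiMetric.IsUniformlyPerfect ρ)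
    (σ : ℝ) (hσ : QuasiMetric.qconst ρ ≤ σ)
    (q : ℝ≥0∞) (hq : 0 < q)
    (s : ℝ) (hs : 0 < s) (hind : QuasiMetric.LEIndex ρ q s) :
    QuasiMetric.IsDoubling ρ μ ↔
      ∃ c₁ c₂ p ω : ℝ, 0 < c₁ ∧ 0 < c₂ ∧ 0 < p ∧ 0 < ω ∧
        ∀ (x₀ : X) (R₀ : ℝ), 0 < R₀ → ∀ u : X → ℝ,
          QuasiMetric.MemHTL ρ μ s p q (QuasiMetric.qball ρ x₀ (σ * R₀)) u →
          0 < QuasiMetric.htlNorm ρ μ s p q (QuasiMetric.qball ρ x₀ (σ * R₀)) u →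
          IntegrableOn u (QuasiMetric.qball ρ x₀ R₀) μ ∧
          ⨍⁻ x in QuasiMetric.qball ρ x₀ R₀,
            ENNReal.ofReal (Real.exp
              ((c₁ * (μ.real (QuasiMetric.qball ρ x₀ (σ * R₀)) ^ (1 / p) *
                  |u x - ⨍ y in QuasiMetric.qball ρ x₀ R₀, u y ∂μ|) /
                (R₀ ^ s *
                  (QuasiMetric.htlNorm ρ μ s p q (QuasiMetric.qball ρ x₀ (σ * R₀)) u).toReal))
                ^ ω)) ∂μ ≤ ENNReal.ofReal c₂ := by
  constructor
  · intro h
    exact h.exp_integrable hX hσ hq hs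
  · rintro ⟨c₁, c₂, p, ω, hc₁, hc₂, hp, hω, h⟩
    exact QuasiMetric.isDoubling_of_exp_integrable hX hσ hq hs hind hc₁ hc₂ hp hω h
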